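/- A straight-line drawing of a finite graph $G$ in the Euclidean plane maps the vertices to distinct points and the edges to the segments joining the points of their endpoints; it is planar if no edge contains a vertex other than its endpoints and any two distinct edges meet at most in a common endpoint. The edge-length ratio of such a drawing is the length of its longest edge divided by the length of its shortest edge, and the edge-length ratio $\rho(G)$ of a planar graph $G$ with at least one edge is the infimum of the edge-length ratios of all planar straight-line drawings of $G$. The class of $2$-trees is defined recursively: a single edge is a $2$-tree, and adding to a $2$-tree a new vertex adjacent to exactly the two endpoints of one of its edges gives a $2$-tree. **Corollary.** The edge-length ratio over the class of $n$-vertex $2$-trees is $\Omega(\log n)$. That is, there are constants $c>0$ and $N$ such that for every integer $n\ge N$ there is a $2$-tree $G$ with exactly $n$ vertices and $\rho(G)\ge c\log n$. -/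

import Mathlib

/-- The Euclidean plane. -/
abbrev Plane : Type := EuclideanSpace ℝ (Fin 2)

/-- The graph obtained from `G` by adding one new vertex `none`, adjacent exactly to `a` and `b`. -/
def addSimplicial {V : Type} (G : SimpleGraph V) (a b : V) : SimpleGraph (Option V) where
  Adj
    | some x, some y => G.Adj x y
    | some x, none => x = a ∨ x = b
    | none, some y => y = a ∨ y = b
    | none, none => False
  symm := ⟨by
    rintro (_ | x) (_ | y) h
    · exact h
    · exact h
    · exact h
    · exact G.adj_symm h⟩
  loopless := ⟨by
    rintro (_ | x) h
    · exact h
    · exact G.irrefl h⟩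

/-- The class of 2-trees (closed under isomorphism): a single edge is a 2-tree, and adding a new
vertex adjacent to exactly the two endpoints of an edge of a 2-tree gives a 2-tree. -/
inductive IsTwoTree : {V : Type} → SimpleGraph V → Prop
  | edge : IsTwoTree (⊤ : SimpleGraph (Fin 2))
  | add {V : Type} {G : SimpleGraph V} {a b : V} (hab : G.Adj a b) (hG : IsTwoTree G) :
      IsTwoTree (addSimplicial G a b)
  | iso {V W : Type} {G : SimpleGraph V} {H : SimpleGraph W} (e : G ≃g H) (hG : IsTwoTree G) :
      IsTwoTree H

/-- `p` places the vertices of `G` so that drawing the edges as straight segments gives a planar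
(crossing-free) drawing: distinct vertices get distinct points, an edge contains no vertex other
than its endpoints, and two distinct edges meet at most in a common endpoint. -/
structure IsPlanarDrawing {V : Type} (G : SimpleGraph V) (p : V → Plane) : Prop where
  injective : Function.Injective p
  vertex_edge : ∀ u v w : V, G.Adj u v → p w ∈ segment ℝ (p u) (p v) → w = u ∨ w = v
  edge_edge : ∀ u v x y : V, G.Adj u v → G.Adj x y → s(u, v) ≠ s(x, y) →
    ∀ P ∈ segment ℝ (p u) (p v) ∩ segment ℝ (p x) (p y),
      ∃ w : V, (w = u ∨ w = v) ∧ (w = x ∨ w = y) ∧ P = p w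

/-- The set of lengths of the edges of `G` in the straight-line drawing `p`. -/
def edgeLengths {V : Type} (G : SimpleGraph V) (p : V → Plane) : Set ℝ :=
  {l | ∃ u v : V, G.Adj u v ∧ l = dist (p u) (p v)}

/-- The edge-length ratio of a drawing of a finite graph with at least one edge: the length of the
longest edge divided by the length of the shortest edge. -/
noncomputable def drawingRatio {V : Type} (G : SimpleGraph V) (p : V → Plane) : ℝ :=
  sSup (edgeLengths G p) / sInf (edgeLengths G p)

/-- The edge-length ratio `ρ(G)`: the infimum of the edge-length ratio over all planar
straight-line drawings of `G`. (It is `0` if there are none, so that a positive lower bound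
on `ρ(G)` includes the existence of a drawing.) -/
noncomputable def edgeLengthRatio {V : Type} (G : SimpleGraph V) : ℝ :=
  sInf {ρ | ∃ p : V → Plane, IsPlanarDrawing G p ∧ ρ = drawingRatio G p}

/-! Scale a planar drawing so that every edge has length at least 1. The claim behind the bound is
that an edge over which common neighbours have been added recursively to depth `18 * m + 3` forces
an edge longer than `m` (`exists_long_edge`). Depth `k` is available with at most `10 ^ k + 1`
vertices, so the depth can be taken of order `log n`.

A drawn triangle acts as a fence: an edge that meets its interior cannot leave it, so the neighbours
of a vertex inside stay in the closed triangle (`edge_confined`, `neighbor_confined`). Among three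
triangles over one edge two lie on the same side, and one of these contains the apex of the other
(`Rich.exists_nested`). From such a nested pair the argument descends, tracking two quantities.

Area: if `x` is inside the triangle `a b y`, nested pairs over `a x` and `b x` live in it with
disjoint interiors, so one of them has at most half the area (`Nested.exists_half`). If all edges
have length at most `m`, linearly many levels in `m` make the area tiny; as edges are not short, the
triangle is then nearly a segment.

Diameter: in such a thin triangle four further levels lower the bound on the side lengths by `1 / 4`
(`HasThin.descend`). Otherwise an inner vertex `v` over a nearly longest edge `a b` would have, on
each side, two triangles that reach past it almost to the other end. Each of these edges passes
above or below `v`, and planarity excludes every combination (`Frame.false_of_wings`). A bound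
starting at `m` would thus fall below 1, which no edge allows.

Since `sInf ∅ = 0`, the lower bound also needs every 2-tree to have a planar drawing
(`IsTwoTree.exists_planarDrawing`). -/

namespace PlanarTwoTree

/-! ### Triangles in barycentric coordinates -/

/-- The cross product of two plane vectors. -/
def cross (u w : Plane) : ℝ := u 0 * w 1 - u 1 * w 0

lemma plane_ext {P Q : Plane} (h0 : P 0 = Q 0) (h1 : P 1 = Q 1) : P = Q := by
  ext i
  fin_cases i
  · exact h0
  · exact h1

lemma cross_sub (a b c : Plane) : cross (b - a) (c - a) =
    (b 0 - a 0) * (c 1 - a 1) - (b 1 - a 1) * (c 0 - a 0) := by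
  simp [cross]

lemma mem_segment_iff {u w Q : Plane} : Q ∈ segment ℝ u w ↔
    ∃ t : ℝ, 0 ≤ t ∧ t ≤ 1 ∧ Q 0 = (1 - t) * u 0 + t * w 0 ∧ Q 1 = (1 - t) * u 1 + t * w 1 := by
  constructor
  · rintro ⟨s, t, hs, ht, hst, rfl⟩
    refine ⟨t, ht, by linarith, ?_, ?_⟩ <;> simp [← hst]
  · rintro ⟨t, h0, h1, e0, e1⟩
    exact ⟨1 - t, t, by linarith, h0, by ring, plane_ext (by simp [e0]) (by simp [e1])⟩

/-- `x, y, z` are barycentric coordinates of `P` with respect to `a, b, c`. -/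
structure IsBary (a b c P : Plane) (x y z : ℝ) : Prop where
  sum : x + y + z = 1
  fst : P 0 = x * a 0 + y * b 0 + z * c 0
  snd : P 1 = x * a 1 + y * b 1 + z * c 1

/-- The closed triangle with corners `a, b, c`. -/
def Tri (a b c : Plane) : Set Plane :=
  {P | ∃ x y z : ℝ, 0 ≤ x ∧ 0 ≤ y ∧ 0 ≤ z ∧ IsBary a b c P x y z}

/-- The open triangle with corners `a, b, c`. -/
def Inner (a b c : Plane) : Set Plane :=
  {P | ∃ x y z : ℝ, 0 < x ∧ 0 < y ∧ 0 < z ∧ IsBary a b c P x y z}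

section Bary

variable {a b c P Q u : Plane} {x y z : ℝ}

lemma IsBary.rotate (h : IsBary a b c P x y z) : IsBary b c a P y z x :=
  ⟨by linarith [h.sum], by linarith [h.fst], by linarith [h.snd]⟩

lemma IsBary.swap (h : IsBary a b c P x y z) : IsBary b a c P y x z :=
  ⟨by linarith [h.sum], by linarith [h.fst], by linarith [h.snd]⟩

lemma Tri.rotate (h : P ∈ Tri a b c) : P ∈ Tri b c a := by
  obtain ⟨x, y, z, hx, hy, hz, hb⟩ := h
  exact ⟨y, z, x, hy, hz, hx, hb.rotate⟩

lemma Tri.swap (h : P ∈ Tri a b c) : P ∈ Tri b a c := by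
  obtain ⟨x, y, z, hx, hy, hz, hb⟩ := h
  exact ⟨y, x, z, hy, hx, hz, hb.swap⟩

lemma Inner.rotate (h : P ∈ Inner a b c) : P ∈ Inner b c a := by
  obtain ⟨x, y, z, hx, hy, hz, hb⟩ := h
  exact ⟨y, z, x, hy, hz, hx, hb.rotate⟩

lemma inner_subset_tri : Inner a b c ⊆ Tri a b c := by
  rintro P ⟨x, y, z, hx, hy, hz, hb⟩
  exact ⟨x, y, z, hx.le, hy.le, hz.le, hb⟩

lemma left_mem_tri : a ∈ Tri a b c :=
  ⟨1, 0, 0, by simp, by simp, by simp, by simp, by simp, by simp⟩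

lemma middle_mem_tri : b ∈ Tri a b c :=
  ⟨0, 1, 0, by simp, by simp, by simp, by simp, by simp, by simp⟩

lemma right_mem_tri : c ∈ Tri a b c :=
  ⟨0, 0, 1, by simp, by simp, by simp, by simp, by simp, by simp⟩

lemma cross_rotate : cross (c - b) (a - b) = cross (b - a) (c - a) := by
  simp only [cross_sub]; ring

lemma exists_isBary (h : cross (b - a) (c - a) ≠ 0) (P : Plane) :
    ∃ x y z : ℝ, IsBary a b c P x y z := by
  have e0 : cross (b - a) (c - a) * P 0 = (cross (b - a) (c - a) - cross (P - a) (c - a)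
      - cross (b - a) (P - a)) * a 0 + cross (P - a) (c - a) * b 0 + cross (b - a) (P - a) * c 0 := by
    simp only [cross_sub]; ring
  have e1 : cross (b - a) (c - a) * P 1 = (cross (b - a) (c - a) - cross (P - a) (c - a)
      - cross (b - a) (P - a)) * a 1 + cross (P - a) (c - a) * b 1 + cross (b - a) (P - a) * c 1 := by
    simp only [cross_sub]; ring
  refine ⟨1 - cross (P - a) (c - a) / cross (b - a) (c - a)
    - cross (b - a) (P - a) / cross (b - a) (c - a),
    cross (P - a) (c - a) / cross (b - a) (c - a),
    cross (b - a) (P - a) / cross (b - a) (c - a), by ring, ?_, ?_⟩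
  · field_simp
    linear_combination e0
  · field_simp
    linear_combination e1

lemma IsBary.eq_snd (h : IsBary a b c P x y z) :
    y * cross (b - a) (c - a) = cross (P - a) (c - a) := by
  have hx : x = 1 - y - z := by linarith [h.sum]
  simp only [cross_sub, h.fst, h.snd, hx]; ring

lemma IsBary.unique {x' y' z' : ℝ} (hn : cross (b - a) (c - a) ≠ 0) (h : IsBary a b c P x y z)
    (h' : IsBary a b c P x' y' z') : x = x' ∧ y = y' ∧ z = z' := by
  have e1 : y = y' := mul_right_cancel₀ hn (h.eq_snd.trans h'.eq_snd.symm)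
  have e2 : z = z' := by
    have hn' : cross (c - b) (a - b) ≠ 0 := by rwa [cross_rotate]
    exact mul_right_cancel₀ hn' (h.rotate.eq_snd.trans h'.rotate.eq_snd.symm)
  exact ⟨by linarith [h.sum, h'.sum], e1, e2⟩

lemma inner_notMem_segment (hn : cross (b - a) (c - a) ≠ 0) (h : P ∈ Inner a b c) :
    P ∉ segment ℝ a b := by
  obtain ⟨x, y, z, hx, hy, hz, hb⟩ := h
  rw [mem_segment_iff]
  rintro ⟨t, -, -, e0, e1⟩
  have := hb.unique hn (x' := 1 - t) (y' := t) (z' := 0)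
    ⟨by ring, by rw [e0]; ring, by rw [e1]; ring⟩
  exact hz.ne' this.2.2

lemma mem_segment_of_isBary_zero (hx : 0 ≤ x) (hy : 0 ≤ y) (h : IsBary a b c P x y 0) :
    P ∈ segment ℝ a b := by
  rw [mem_segment_iff]
  have hx' : x = 1 - y := by linarith [h.sum]
  exact ⟨y, hy, by linarith, by rw [h.fst, hx']; ring, by rw [h.snd, hx']; ring⟩

lemma inner_or_side (h : P ∈ Tri a b c) : P ∈ Inner a b c ∨ P ∈ segment ℝ a b ∨
    P ∈ segment ℝ b c ∨ P ∈ segment ℝ c a := by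
  obtain ⟨x, y, z, hx, hy, hz, hb⟩ := h
  rcases hx.eq_or_lt with rfl | hx'
  · exact .inr (.inr (.inl (mem_segment_of_isBary_zero hy hz hb.rotate)))
  rcases hy.eq_or_lt with rfl | hy'
  · exact .inr (.inr (.inr (mem_segment_of_isBary_zero hz hx hb.rotate.rotate)))
  rcases hz.eq_or_lt with rfl | hz'
  · exact .inr (.inl (mem_segment_of_isBary_zero hx hy hb))
  exact .inl ⟨x, y, z, hx', hy', hz', hb⟩

/-- A segment from an inner point to a point outside of a triangle meets one of the sides. -/
lemma exists_mem_side (hn : cross (b - a) (c - a) ≠ 0) (hP : P ∈ Inner a b c)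
    (hu : u ∉ Tri a b c) : ∃ Q ∈ segment ℝ P u, Q ∈ Tri a b c ∧
      (Q ∈ segment ℝ a b ∨ Q ∈ segment ℝ b c ∨ Q ∈ segment ℝ c a) := by
  obtain ⟨x, y, z, hx, hy, hz, hb⟩ := hP
  obtain ⟨x', y', z', hb'⟩ := exists_isBary hn u
  -- The least barycentric coordinate is positive at `P` and, after excluding a point of the
  -- triangle, at most 0 at `u`. At a zero of it all coordinates are nonnegative and one vanishes,
  -- which is a point of a side.
  set m : ℝ → ℝ := fun t => min (min ((1 - t) * x + t * x') ((1 - t) * y + t * y'))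
    ((1 - t) * z + t * z') with hm
  have hm0 : 0 ≤ m 0 := by simp [hm, hx.le, hy.le, hz.le]
  have hm1 : m 1 ≤ 0 := by
    by_contra! hcon
    simp only [hm, sub_self, zero_mul, one_mul, zero_add, lt_min_iff] at hcon
    exact hu ⟨x', y', z', hcon.1.1.le, hcon.1.2.le, hcon.2.le, hb'⟩
  have hc : ContinuousOn m (Set.Icc 0 1) := by
    apply Continuous.continuousOn
    simp only [hm]
    fun_prop
  obtain ⟨t, ⟨ht0, ht1⟩, ht⟩ := intermediate_value_Icc' (zero_le_one' ℝ) hc ⟨hm1, hm0⟩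
  let Q : Plane := (1 - t) • P + t • u
  have hQ : IsBary a b c Q ((1 - t) * x + t * x') ((1 - t) * y + t * y')
      ((1 - t) * z + t * z') := by
    refine ⟨by linear_combination (1 - t) * hb.sum + t * hb'.sum, ?_, ?_⟩
    · simp only [Q, PiLp.add_apply, PiLp.smul_apply, smul_eq_mul, hb.fst, hb'.fst]; ring
    · simp only [Q, PiLp.add_apply, PiLp.smul_apply, smul_eq_mul, hb.snd, hb'.snd]; ring
  have hpos : 0 ≤ m t := ht.ge
  simp only [hm, le_min_iff] at hpos
  obtain ⟨⟨p1, p2⟩, p3⟩ := hpos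
  refine ⟨Q, ⟨1 - t, t, by linarith, ht0, by ring, rfl⟩, ⟨_, _, _, p1, p2, p3, hQ⟩, ?_⟩
  rcases min_choice (min ((1 - t) * x + t * x') ((1 - t) * y + t * y'))
    ((1 - t) * z + t * z') with h1 | h1
  · rcases min_choice ((1 - t) * x + t * x') ((1 - t) * y + t * y') with h2 | h2
    · have h3 : (1 - t) * x + t * x' = 0 := by rw [← h2, ← h1]; exact ht
      rw [h3] at hQ
      exact .inr (.inl (mem_segment_of_isBary_zero p2 p3 hQ.rotate))
    · have h3 : (1 - t) * y + t * y' = 0 := by rw [← h2, ← h1]; exact ht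
      rw [h3] at hQ
      exact .inr (.inr (mem_segment_of_isBary_zero p3 p1 hQ.rotate.rotate))
  · have h3 : (1 - t) * z + t * z' = 0 := by rw [← h1]; exact ht
    rw [h3] at hQ
    exact .inl (mem_segment_of_isBary_zero p1 p2 hQ)

lemma eq_of_isBary_one (h : IsBary a b c P x y z) (hx : 1 ≤ x) (hy : 0 ≤ y) (hz : 0 ≤ z) :
    P = a := by
  have hs := h.sum
  obtain rfl : x = 1 := by linarith
  obtain rfl : y = 0 := by linarith
  obtain rfl : z = 0 := by linarith
  exact plane_ext (by rw [h.fst]; ring) (by rw [h.snd]; ring)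

/-- A corner of a triangle is an extreme point. -/
lemma corner_notMem_tri (hn : cross (b - a) (c - a) ≠ 0) {u v w : Plane} (hu : u ∈ Tri a b c)
    (hv : v ∈ Tri a b c) (hw : w ∈ Tri a b c) (hua : u ≠ a) (hva : v ≠ a) (hwa : w ≠ a) :
    a ∉ Tri u v w := by
  rintro ⟨r, s, t, hr, hs, ht, hb⟩
  obtain ⟨x1, y1, z1, p1, q1, r1, b1⟩ := hu
  obtain ⟨x2, y2, z2, p2, q2, r2, b2⟩ := hv
  obtain ⟨x3, y3, z3, p3, q3, r3, b3⟩ := hw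
  have l1 : x1 < 1 := by
    by_contra! hcon; exact hua (eq_of_isBary_one b1 hcon q1 r1)
  have l2 : x2 < 1 := by
    by_contra! hcon; exact hva (eq_of_isBary_one b2 hcon q2 r2)
  have l3 : x3 < 1 := by
    by_contra! hcon; exact hwa (eq_of_isBary_one b3 hcon q3 r3)
  have key := (IsBary.unique hn (P := a) (x := 1) (y := 0) (z := 0) ⟨by simp, by simp, by simp⟩
    (x' := r * x1 + s * x2 + t * x3) (y' := r * y1 + s * y2 + t * y3)
    (z' := r * z1 + s * z2 + t * z3)
    ⟨by linear_combination r * b1.sum + s * b2.sum + t * b3.sum + hb.sum,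
     by linear_combination hb.fst + r * b1.fst + s * b2.fst + t * b3.fst,
     by linear_combination hb.snd + r * b1.snd + s * b2.snd + t * b3.snd⟩).1
  have hsum := hb.sum
  have : r * (1 - x1) + s * (1 - x2) + t * (1 - x3) = 0 := by linear_combination hsum + key
  have a1 : 0 ≤ r * (1 - x1) := mul_nonneg hr (by linarith)
  have a2 : 0 ≤ s * (1 - x2) := mul_nonneg hs (by linarith)
  have a3 : 0 ≤ t * (1 - x3) := mul_nonneg ht (by linarith)
  have c1 : r = 0 := by
    rcases mul_eq_zero.1 (show r * (1 - x1) = 0 by linarith) with h | h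
    · exact h
    · linarith
  have c2 : s = 0 := by
    rcases mul_eq_zero.1 (show s * (1 - x2) = 0 by linarith) with h | h
    · exact h
    · linarith
  have c3 : t = 0 := by
    rcases mul_eq_zero.1 (show t * (1 - x3) = 0 by linarith) with h | h
    · exact h
    · linarith
  rw [c1, c2, c3] at hsum
  norm_num at hsum

lemma tri_subset {u v w : Plane} (hu : u ∈ Tri a b c)
    (hv : v ∈ Tri a b c) (hw : w ∈ Tri a b c) : Tri u v w ⊆ Tri a b c := by
  rintro P ⟨r, s, t, hr, hs, ht, hb⟩
  obtain ⟨x1, y1, z1, p1, q1, r1, b1⟩ := hu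
  obtain ⟨x2, y2, z2, p2, q2, r2, b2⟩ := hv
  obtain ⟨x3, y3, z3, p3, q3, r3, b3⟩ := hw
  exact ⟨r * x1 + s * x2 + t * x3, r * y1 + s * y2 + t * y3, r * z1 + s * z2 + t * z3,
    by positivity, by positivity, by positivity,
    by linear_combination r * b1.sum + s * b2.sum + t * b3.sum + hb.sum,
    by linear_combination hb.fst + r * b1.fst + s * b2.fst + t * b3.fst,
    by linear_combination hb.snd + r * b1.snd + s * b2.snd + t * b3.snd⟩

/-- The points of a segment from an inner point to a point of the triangle, other than the
second endpoint, are inner points. -/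
lemma inner_of_mem_segment (hP : P ∈ Inner a b c) (hu : u ∈ Tri a b c) (hQ : Q ∈ segment ℝ P u)
    (hne : Q ≠ u) : Q ∈ Inner a b c := by
  obtain ⟨x, y, z, hx, hy, hz, hb⟩ := hP
  obtain ⟨x', y', z', hx', hy', hz', hb'⟩ := hu
  obtain ⟨t, ht0, ht1, e0, e1⟩ := mem_segment_iff.1 hQ
  have ht : t < 1 := by
    rcases ht1.lt_or_eq with h | rfl
    · exact h
    · exact (hne (plane_ext (by rw [e0]; ring) (by rw [e1]; ring))).elim
  have ht' : 0 < 1 - t := by linarith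
  exact ⟨(1 - t) * x + t * x', (1 - t) * y + t * y', (1 - t) * z + t * z',
    by positivity, by positivity, by positivity,
    by linear_combination (1 - t) * hb.sum + t * hb'.sum,
    by rw [e0, hb.fst, hb'.fst]; ring, by rw [e1, hb.snd, hb'.snd]; ring⟩

end Bary

/-! ### Confinement in planar drawings -/

/-- `a, b, c` span a triangle of `G`. -/
structure IsTriangle {V : Type} (G : SimpleGraph V) (a b c : V) : Prop where
  ab : G.Adj a b
  bc : G.Adj b c
  ca : G.Adj c a

lemma IsTriangle.rotate {V : Type} {G : SimpleGraph V} {a b c : V} (h : IsTriangle G a b c) :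
    IsTriangle G b c a := ⟨h.bc, h.ca, h.ab⟩

lemma IsTriangle.swap {V : Type} {G : SimpleGraph V} {a b c : V} (h : IsTriangle G a b c) :
    IsTriangle G b a c := ⟨h.ab.symm, h.ca.symm, h.bc.symm⟩

section Drawing

variable {V : Type} {G : SimpleGraph V} {p : V → Plane} {a b c u v w x : V}

/-- Two neighbours of a vertex are not in the same direction. -/
lemma cross_ne_zero_of_ray (h : IsPlanarDrawing G p) (hab : G.Adj a b) (hac : G.Adj a c)
    (hbc : b ≠ c) {φ : Plane → ℝ} {α β : ℝ} (hφ : ∀ P, φ P = α * P 0 + β * P 1)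
    (hb : 0 < φ (p b - p a)) (hc : 0 < φ (p c - p a)) :
    cross (p b - p a) (p c - p a) ≠ 0 := by
  intro h0
  wlog hle : φ (p b - p a) ≤ φ (p c - p a) generalizing b c
  · refine this hac hab hbc.symm hc hb ?_ (by linarith)
    simp only [cross_sub] at h0 ⊢
    linarith
  have hmem : p b ∈ segment ℝ (p a) (p c) := by
    rw [mem_segment_iff]
    refine ⟨φ (p b - p a) / φ (p c - p a), by positivity, (div_le_one hc).2 hle, ?_, ?_⟩
    · field_simp
      simp only [hφ, cross_sub, PiLp.sub_apply] at h0 hb hc ⊢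
      linear_combination β * h0
    · field_simp
      simp only [hφ, cross_sub, PiLp.sub_apply] at h0 hb hc ⊢
      linear_combination -α * h0
  rcases h.vertex_edge a c b hac hmem with h1 | h1
  · exact hab.ne h1.symm
  · exact hbc h1

/-- Of three collinear points one lies between the other two, so a degenerate triangle would have a
vertex on the opposite edge. -/
lemma cross_ne_zero (h : IsPlanarDrawing G p) (ht : IsTriangle G a b c) :
    cross (p b - p a) (p c - p a) ≠ 0 := by
  intro h0
  have hne : p b ≠ p a := fun e => ht.ab.ne (h.injective e.symm)
  set α : ℝ := p b 0 - p a 0 with hα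
  set β : ℝ := p b 1 - p a 1 with hβ
  have hpos : 0 < α ^ 2 + β ^ 2 := by
    by_contra! hcon
    have h1 : α = 0 := by nlinarith [sq_nonneg α, sq_nonneg β]
    have h2 : β = 0 := by nlinarith [sq_nonneg α, sq_nonneg β]
    exact hne (plane_ext (by linarith) (by linarith))
  let φ : Plane → ℝ := fun P => α * P 0 + β * P 1
  have hφb : 0 < φ (p b - p a) := by
    simp only [φ, PiLp.sub_apply, ← hα, ← hβ]; nlinarith
  rcases lt_trichotomy (φ (p c - p a)) 0 with hneg | hz | hc
  · have hmem : p a ∈ segment ℝ (p b) (p c) := by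
      rw [mem_segment_iff]
      have hd : 0 < φ (p b - p a) - φ (p c - p a) := by linarith
      refine ⟨φ (p b - p a) / (φ (p b - p a) - φ (p c - p a)), by positivity,
        (div_le_one hd).2 (by linarith), ?_, ?_⟩
      · field_simp
        simp only [φ, cross_sub, PiLp.sub_apply] at h0 ⊢
        linear_combination β * h0
      · field_simp
        simp only [φ, cross_sub, PiLp.sub_apply] at h0 ⊢
        linear_combination -α * h0
    rcases h.vertex_edge b c a ht.bc hmem with h1 | h1
    · exact ht.ab.ne h1
    · exact ht.ca.ne h1.symm
  · simp only [φ, cross_sub, PiLp.sub_apply, ← hα, ← hβ] at h0 hz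
    have e0 : (α ^ 2 + β ^ 2) * (p c 0 - p a 0) = 0 := by linear_combination α * hz - β * h0
    have e1 : (α ^ 2 + β ^ 2) * (p c 1 - p a 1) = 0 := by linear_combination β * hz + α * h0
    rcases mul_eq_zero.1 e0 with e | e0
    · linarith
    rcases mul_eq_zero.1 e1 with e | e1
    · linarith
    exact ht.ca.ne (h.injective (plane_ext (by linarith) (by linarith)))
  · exact cross_ne_zero_of_ray h ht.ab ht.ca.symm ht.bc.ne (φ := φ) (fun _ => rfl) hφb hc h0

/-- An edge meeting the inside of a drawn triangle stays in the triangle. -/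
lemma edge_confined (h : IsPlanarDrawing G p) (ht : IsTriangle G a b c) (huw : G.Adj u w)
    {P : Plane} (hP : P ∈ segment ℝ (p u) (p w)) (hin : P ∈ Inner (p a) (p b) (p c)) :
    p u ∈ Tri (p a) (p b) (p c) := by
  by_contra hu
  obtain ⟨Q, hQ, hQt, hside⟩ := exists_mem_side (cross_ne_zero h ht) hin hu
  have main : ∀ {a b c : V}, IsTriangle G a b c → P ∈ Inner (p a) (p b) (p c) →
      p u ∉ Tri (p a) (p b) (p c) → Q ∉ segment ℝ (p a) (p b) := by
    intro a b c ht hin hu hside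
    have hQ' : Q ∈ segment ℝ (p u) (p w) :=
      (convex_segment (p u) (p w)).segment_subset hP (left_mem_segment ℝ _ _) hQ
    have hPn : P ∉ segment ℝ (p a) (p b) := inner_notMem_segment (cross_ne_zero h ht) hin
    have hne : s(u, w) ≠ s(a, b) := by
      intro e
      rcases Sym2.eq_iff.1 e with ⟨rfl, rfl⟩ | ⟨rfl, rfl⟩
      · exact hPn hP
      · exact hPn (segment_symm ℝ (p u) (p w) ▸ hP)
    obtain ⟨z, hz1, hz2, rfl⟩ := h.edge_edge u w a b huw ht.ab hne Q ⟨hQ', hside⟩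
    have hzt : p z ∈ Tri (p a) (p b) (p c) := by
      rcases hz2 with rfl | rfl
      · exact left_mem_tri
      · exact middle_mem_tri
    rcases hz1 with rfl | rfl
    · exact hu hzt
    -- Here `Q` is the other endpoint of the edge. Since it lies between `P` and `p u`, it must
    -- equal `P`, which would then be on a side of the triangle.
    · obtain ⟨s, hs0, hs1, e0, e1⟩ := mem_segment_iff.1 hP
      obtain ⟨t, ht0, ht1, f0, f1⟩ := mem_segment_iff.1 hQ
      have hwu : p z ≠ p u := fun e => huw.ne (h.injective e.symm)
      have hk : (1 - (1 - t) * s) * (p z 0 - p u 0) = 0 := by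
        rw [e0] at f0; linear_combination f0
      have hk' : (1 - (1 - t) * s) * (p z 1 - p u 1) = 0 := by
        rw [e1] at f1; linear_combination f1
      have hst : 1 - (1 - t) * s = 0 := by
        by_contra hcon
        apply hwu
        apply plane_ext
        · rcases mul_eq_zero.1 hk with e | e
          · exact (hcon e).elim
          · linarith
        · rcases mul_eq_zero.1 hk' with e | e
          · exact (hcon e).elim
          · linarith
      have hs : s = 1 := by nlinarith
      apply hPn
      have : P = p z := plane_ext (by rw [e0, hs]; ring) (by rw [e1, hs]; ring)
      rw [this]; exact hside
  rcases hside with hs | hs | hs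
  · exact main ht hin hu hs
  · exact main ht.rotate (Inner.rotate hin) (fun e => hu (Tri.rotate (Tri.rotate e))) hs
  · exact main ht.rotate.rotate (Inner.rotate (Inner.rotate hin)) (fun e => hu (Tri.rotate e)) hs

/-- A vertex in a drawn triangle that is not a corner is an inner point. -/
lemma vertex_mem_inner (h : IsPlanarDrawing G p) (ht : IsTriangle G a b c)
    (hx : p x ∈ Tri (p a) (p b) (p c)) (ha : x ≠ a) (hb : x ≠ b) (hc : x ≠ c) :
    p x ∈ Inner (p a) (p b) (p c) := by
  rcases inner_or_side hx with h1 | h1 | h1 | h1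
  · exact h1
  · rcases h.vertex_edge a b x ht.ab h1 with e | e
    · exact (ha e).elim
    · exact (hb e).elim
  · rcases h.vertex_edge b c x ht.bc h1 with e | e
    · exact (hb e).elim
    · exact (hc e).elim
  · rcases h.vertex_edge c a x ht.ca h1 with e | e
    · exact (hc e).elim
    · exact (ha e).elim

/-- Neighbours of a vertex inside a drawn triangle lie in the triangle. -/
lemma neighbor_confined (h : IsPlanarDrawing G p) (ht : IsTriangle G a b c)
    (hx : p x ∈ Tri (p a) (p b) (p c)) (ha : x ≠ a) (hb : x ≠ b) (hc : x ≠ c)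
    (hxu : G.Adj x u) : p u ∈ Tri (p a) (p b) (p c) :=
  edge_confined h ht hxu.symm (right_mem_segment ℝ _ _) (vertex_mem_inner h ht hx ha hb hc)

/-- A neighbour of `a` in a direction inside the angle at `a` of a drawn triangle lies in
the triangle. -/
lemma mem_tri_of_cone (h : IsPlanarDrawing G p) (ht : IsTriangle G a b c) (haw : G.Adj a w)
    {σ : ℝ} (h1 : 0 < σ * cross (p b - p a) (p c - p a))
    (h2 : 0 < σ * cross (p b - p a) (p w - p a)) (h3 : 0 < σ * cross (p w - p a) (p c - p a)) :
    p w ∈ Tri (p a) (p b) (p c) := by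
  set D := σ * cross (p b - p a) (p c - p a) with hD
  set B := σ * cross (p w - p a) (p c - p a) with hB
  set C := σ * cross (p b - p a) (p w - p a) with hC
  have hs : 0 < D + B + C := by positivity
  -- This `t` is small enough that the point at ratio `t` on the edge is still inside: its
  -- barycentric coordinates are `D`, `B`, `C` divided by their sum.
  set t := D / (D + B + C) with ht'
  let P : Plane := (1 - t) • p a + t • p w
  have ht0 : 0 ≤ t := by positivity
  have ht1 : t ≤ 1 := (div_le_one hs).2 (by linarith)
  refine edge_confined h ht haw.symm (P := P) ?_ ⟨D / (D + B + C), B / (D + B + C),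
    C / (D + B + C), by positivity, by positivity, by positivity, by field_simp, ?_, ?_⟩
  · rw [segment_symm]
    exact ⟨1 - t, t, by linarith, ht0, by ring, rfl⟩
  · simp only [P, PiLp.add_apply, PiLp.smul_apply, smul_eq_mul, ht']
    field_simp
    simp only [hD, hB, hC, cross_sub]
    ring
  · simp only [P, PiLp.add_apply, PiLp.smul_apply, smul_eq_mul, ht']
    field_simp
    simp only [hD, hB, hC, cross_sub]
    ring

/-- Two triangles on the same side of a common edge are nested. -/
lemma nested_of_same_side (h : IsPlanarDrawing G p) (hb : IsTriangle G a b c)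
    (hc : IsTriangle G a b w) (hne : c ≠ w) {σ : ℝ}
    (h1 : 0 < σ * cross (p b - p a) (p c - p a)) (h2 : 0 < σ * cross (p b - p a) (p w - p a)) :
    p c ∈ Tri (p a) (p b) (p w) ∨ p w ∈ Tri (p a) (p b) (p c) := by
  -- The functional is the signed height over the line `a b`. Being in different directions from
  -- `a`, one of the two apexes lies in the angle at `a` of the other triangle.
  have hn := cross_ne_zero_of_ray h hb.ca.symm hc.ca.symm hne
    (φ := fun P => σ * (p b 0 - p a 0) * P 1 - σ * (p b 1 - p a 1) * P 0)
    (α := - σ * (p b 1 - p a 1)) (β := σ * (p b 0 - p a 0)) (fun P => by ring)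
    (by simp only [cross_sub] at h1; simp only [PiLp.sub_apply]; linarith)
    (by simp only [cross_sub] at h2; simp only [PiLp.sub_apply]; linarith)
  have hσ : σ ≠ 0 := by rintro rfl; simp at h1
  rcases lt_or_gt_of_ne (mul_ne_zero hσ hn) with h3 | h3
  · right
    refine mem_tri_of_cone h hb hc.ca.symm h1 h2 ?_
    simp only [cross_sub] at h3 ⊢; linarith
  · left
    exact mem_tri_of_cone h hc hb.ca.symm h2 h1 h3

end Drawing

/-! ### Deep subtrees -/

/-- The edge `ab` of `G` carries a subtree of depth `k` in which each edge gets five new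
common neighbours. -/
def Rich {V : Type} (G : SimpleGraph V) : ℕ → V → V → Prop
  | 0, a, b => G.Adj a b
  | k + 1, a, b => G.Adj a b ∧
      ∃ C : Finset V, 5 ≤ C.card ∧ ∀ c ∈ C, Rich G k a c ∧ Rich G k b c

section Rich

variable {V : Type} {G : SimpleGraph V} {p : V → Plane} {a b c u v w x y : V} {k : ℕ}

lemma Rich.adj (h : Rich G k a b) : G.Adj a b := by
  cases k with
  | zero => exact h
  | succ k => exact h.1

lemma Rich.symm (h : Rich G k a b) : Rich G k b a := by
  cases k with
  | zero => exact SimpleGraph.Adj.symm h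
  | succ k =>
    obtain ⟨h, C, hC, hc⟩ := h
    exact ⟨h.symm, C, hC, fun c hcC => (hc c hcC).symm⟩

lemma Rich.pred (h : Rich G (k + 1) a b) : Rich G k a b := by
  induction k generalizing a b with
  | zero => exact h.adj
  | succ k ih =>
    obtain ⟨h, C, hC, hc⟩ := h
    exact ⟨h, C, hC, fun c hcC => ⟨ih (hc c hcC).1, ih (hc c hcC).2⟩⟩

lemma Rich.mono {j : ℕ} (h : Rich G k a b) (hj : j ≤ k) : Rich G j a b := by
  induction k, hj using Nat.le_induction with
  | base => exact h
  | succ k _ ih => exact ih h.pred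

lemma Rich.map {W : Type} {H : SimpleGraph W} (f : G →g H) (hf : Function.Injective f)
    (h : Rich G k a b) : Rich H k (f a) (f b) := by
  induction k generalizing a b with
  | zero => exact f.map_adj h
  | succ k ih =>
    obtain ⟨h, C, hC, hc⟩ := h
    refine ⟨f.map_adj h, C.map ⟨f, hf⟩, by simpa using hC, ?_⟩
    intro c hcC
    obtain ⟨d, hd, rfl⟩ := Finset.mem_map.1 hcC
    exact ⟨ih (hc d hd).1, ih (hc d hd).2⟩

/-- The triangle `a b y` is drawn with the vertex `x` inside, and all of its edges, as well as
`a x` and `b x`, carry subtrees of depth `k`. -/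
structure Nested (G : SimpleGraph V) (p : V → Plane) (k : ℕ) (a b y x : V) : Prop where
  ab : Rich G k a b
  ay : Rich G k a y
  yb : Rich G k y b
  ax : Rich G k a x
  xb : Rich G k x b
  ne : x ≠ y
  mem : p x ∈ Tri (p a) (p b) (p y)

lemma Nested.isTriangle (h : Nested G p k a b y x) : IsTriangle G a b y :=
  ⟨h.ab.adj, h.yb.adj.symm, h.ay.adj.symm⟩

lemma Nested.mono {j : ℕ} (h : Nested G p k a b y x) (hj : j ≤ k) : Nested G p j a b y x :=
  ⟨h.ab.mono hj, h.ay.mono hj, h.yb.mono hj, h.ax.mono hj, h.xb.mono hj, h.ne, h.mem⟩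

lemma Nested.swap (h : Nested G p k a b y x) : Nested G p k b a y x :=
  ⟨h.ab.symm, h.yb.symm, h.ay.symm, h.xb.symm, h.ax.symm, h.ne, Tri.swap h.mem⟩

lemma Nested.neighbor_mem (hp : IsPlanarDrawing G p) (h : Nested G p k a b y x)
    (hxu : G.Adj x u) : p u ∈ Tri (p a) (p b) (p y) :=
  neighbor_confined hp h.isTriangle h.mem h.ax.adj.ne.symm h.xb.adj.ne h.ne hxu

/-- Among three triangles over a common edge, two are on the same side, hence nested. -/
lemma Rich.exists_nested [DecidableEq V] (hp : IsPlanarDrawing G p) (h : Rich G (k + 1) a b)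
    (s t : V) : ∃ y x, y ≠ s ∧ y ≠ t ∧ x ≠ s ∧ x ≠ t ∧ Nested G p k a b y x := by
  have hab := h.pred
  obtain ⟨h, C, hC, hc⟩ := h
  -- This is where five neighbours are needed: three for the pigeonhole on sides and two more to
  -- avoid `s` and `t`.
  have hcard : 2 < ((C.erase s).erase t).card := by
    have h1 := Finset.pred_card_le_card_erase (s := C) (a := s)
    have h2 := Finset.pred_card_le_card_erase (s := C.erase s) (a := t)
    omega
  obtain ⟨x, hx, y, hy, z, hz, hxy, hxz, hyz⟩ := Finset.two_lt_card.1 hcard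
  have main : ∀ x y, x ∈ (C.erase s).erase t → y ∈ (C.erase s).erase t → x ≠ y → ∀ σ : ℝ,
      0 < σ * cross (p b - p a) (p x - p a) → 0 < σ * cross (p b - p a) (p y - p a) →
      ∃ y x, y ≠ s ∧ y ≠ t ∧ x ≠ s ∧ x ≠ t ∧ Nested G p k a b y x := by
    intro x y hx hy hxy σ h1 h2
    simp only [Finset.mem_erase] at hx hy
    obtain ⟨rx, rx'⟩ := hc x hx.2.2
    obtain ⟨ry, ry'⟩ := hc y hy.2.2
    rcases nested_of_same_side hp ⟨h, rx'.adj, rx.adj.symm⟩ ⟨h, ry'.adj, ry.adj.symm⟩ hxy h1 h2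
      with hm | hm
    · exact ⟨y, x, hy.2.1, hy.1, hx.2.1, hx.1, hab, ry, ry'.symm, rx, rx'.symm, hxy, hm⟩
    · exact ⟨x, y, hx.2.1, hx.1, hy.2.1, hy.1, hab, rx, rx'.symm, ry, ry'.symm, hxy.symm, hm⟩
  have hne : ∀ x ∈ (C.erase s).erase t, cross (p b - p a) (p x - p a) ≠ 0 := by
    intro x hx
    simp only [Finset.mem_erase] at hx
    obtain ⟨rx, rx'⟩ := hc x hx.2.2
    exact cross_ne_zero hp ⟨h, rx'.adj, rx.adj.symm⟩
  rcases lt_or_gt_of_ne (hne x hx) with sx | sx <;>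
    rcases lt_or_gt_of_ne (hne y hy) with sy | sy <;>
    rcases lt_or_gt_of_ne (hne z hz) with sz | sz
  · exact main x y hx hy hxy (-1) (by linarith) (by linarith)
  · exact main x y hx hy hxy (-1) (by linarith) (by linarith)
  · exact main x z hx hz hxz (-1) (by linarith) (by linarith)
  · exact main y z hy hz hyz 1 (by linarith) (by linarith)
  · exact main y z hy hz hyz (-1) (by linarith) (by linarith)
  · exact main x z hx hz hxz 1 (by linarith) (by linarith)
  · exact main x y hx hy hxy 1 (by linarith) (by linarith)
  · exact main x y hx hy hxy 1 (by linarith) (by linarith)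

end Rich

end PlanarTwoTree

namespace PlanarTwoTree

/-! ### Triangles spanned by a left, a middle and a right vertex -/

/-- A linear functional on the plane. -/
def lin (α β : ℝ) (P : Plane) : ℝ := α * P 0 + β * P 1

lemma lin_neg (α β : ℝ) (P : Plane) : lin (-α) (-β) P = -lin α β P := by
  simp only [lin]; ring

lemma cross_swap (x y : Plane) : cross x y = -cross y x := by
  simp only [cross]; ring

lemma lin_cross (α β : ℝ) (x y z : Plane) :
    lin α β x * cross y z + lin α β y * cross z x + lin α β z * cross x y = 0 := by
  simp only [lin, cross]; ring

section Frame

variable {V : Type} {G : SimpleGraph V} {p : V → Plane} {a b c v l r w : V} {α β σ : ℝ}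

/-- With `l`, `w` to the left of `v` and `r` to the right, the linear relation `lin_cross` between
three plane vectors yields the missing sign, so `w` points into the angle at `v` between `r` and
`l`. -/
lemma mem_tri_of_left (h : IsPlanarDrawing G p) (ht : IsTriangle G v r l) (hw : G.Adj v w)
    (hl : lin α β (p l - p v) < 0) (hr : 0 < lin α β (p r - p v))
    (hwn : lin α β (p w - p v) < 0) (h1 : 0 < σ * cross (p r - p v) (p l - p v))
    (h2 : 0 < σ * cross (p w - p v) (p l - p v)) : p w ∈ Tri (p v) (p r) (p l) := by
  refine mem_tri_of_cone h ht hw h1 ?_ h2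
  have key := lin_cross α β (p l - p v) (p r - p v) (p w - p v)
  rw [cross_swap (p l - p v) (p r - p v)] at key
  have e1 := mul_pos hr h2
  have e2 := mul_pos_of_neg_of_neg hwn (neg_neg_of_pos h1)
  refine pos_of_mul_neg_right ?_ hl.le
  linear_combination e1 + e2 + σ * key

lemma mem_tri_of_right (h : IsPlanarDrawing G p) (ht : IsTriangle G v r l) (hw : G.Adj v w)
    (hl : lin α β (p l - p v) < 0) (hr : 0 < lin α β (p r - p v))
    (hwn : 0 < lin α β (p w - p v)) (h1 : 0 < σ * cross (p r - p v) (p l - p v))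
    (h2 : 0 < σ * cross (p r - p v) (p w - p v)) : p w ∈ Tri (p v) (p r) (p l) := by
  refine Tri.rotate (Tri.swap (mem_tri_of_left (α := -α) (β := -β) (σ := -σ) h
    ht.swap.rotate hw ?_ ?_ ?_ ?_ ?_))
  · rw [lin_neg]; linarith
  · rw [lin_neg]; linarith
  · rw [lin_neg]; linarith
  · rw [cross_swap]; linarith
  · rw [cross_swap]; linarith

/-- The vertex `v` lies in the drawn triangle `a b c`, with `a` to the left and `b` to the right
with respect to the functional `lin α β`. -/
structure Frame (G : SimpleGraph V) (p : V → Plane) (α β : ℝ) (a b c v : V) : Prop where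
  tri : IsTriangle G a b c
  mem : p v ∈ Tri (p a) (p b) (p c)
  va : G.Adj v a
  vb : G.Adj v b
  vc : v ≠ c
  left : lin α β (p a - p v) < 0
  right : 0 < lin α β (p b - p v)

lemma Frame.swap (F : Frame G p α β a b c v) : Frame G p (-α) (-β) b a c v where
  tri := F.tri.swap
  mem := Tri.swap F.mem
  va := F.vb
  vb := F.va
  vc := F.vc
  left := by rw [lin_neg]; linarith [F.right]
  right := by rw [lin_neg]; linarith [F.left]

lemma Frame.neighbor_mem (h : IsPlanarDrawing G p) (F : Frame G p α β a b c v)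
    (hw : G.Adj v w) : p w ∈ Tri (p a) (p b) (p c) :=
  neighbor_confined h F.tri F.mem F.va.ne F.vb.ne F.vc hw

/-- By confinement `x` and `y` lie in the triangle `a b c`, of which `a` is an extreme point. This
is the source of all contradictions below. -/
lemma Frame.left_notMem (h : IsPlanarDrawing G p) (F : Frame G p α β a b c v)
    {x y : V} (hx : G.Adj v x) (hy : G.Adj v y) (hxa : x ≠ a) (hya : y ≠ a) :
    p a ∉ Tri (p v) (p x) (p y) :=
  corner_notMem_tri (cross_ne_zero h F.tri) F.mem (F.neighbor_mem h hx) (F.neighbor_mem h hy)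
    (fun e => F.va.ne (h.injective e)) (fun e => hxa (h.injective e))
    (fun e => hya (h.injective e))

/-- If `a b` passes below `v` and `v b l` is a triangle with `l` to the left of `v`, then either
`l` is above `a` and `l b` passes above `v`, or `l` is below `a` and `l b` passes below `v`. -/
lemma Frame.above_or_below (h : IsPlanarDrawing G p) (F : Frame G p α β a b c v)
    (hlv : G.Adj v l) (hlb : G.Adj b l) (hla : l ≠ a)
    (hl : lin α β (p l - p v) < 0) (hσ : σ ≠ 0) :
    (0 < σ * cross (p l - p v) (p a - p v) ∧ 0 < σ * cross (p b - p v) (p l - p v)) ∨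
    (σ * cross (p l - p v) (p a - p v) < 0 ∧ σ * cross (p b - p v) (p l - p v) < 0) := by
  have ht : IsTriangle G v b l := ⟨F.vb, hlb, hlv.symm⟩
  have hn : cross (p l - p v) (p a - p v) ≠ 0 :=
    cross_ne_zero_of_ray h hlv F.va hla (φ := lin (-α) (-β)) (fun _ => rfl)
      (by rw [lin_neg]; linarith) (by rw [lin_neg]; linarith [F.left])
  have hnot := F.left_notMem h F.vb hlv F.tri.ab.ne.symm hla
  rcases lt_or_gt_of_ne (mul_ne_zero hσ hn) with h1 | h1 <;>
    rcases lt_or_gt_of_ne (mul_ne_zero hσ (cross_ne_zero h ht)) with h2 | h2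
  · exact .inr ⟨h1, h2⟩
  · exact (hnot (mem_tri_of_left h ht F.va hl F.right F.left h2
      (by rw [cross_swap]; linarith))).elim
  · exact (hnot (mem_tri_of_left (σ := -σ) h ht F.va hl F.right F.left (by linarith)
      (by rw [cross_swap]; linarith))).elim
  · exact .inl ⟨h1, h2⟩

/-- Take `σ = 1` and the picture with counterclockwise orientation: `l` is below `a`, and the edge
`a r` passes below `v`. Then `l` is trapped in the triangle `v r a`, hence so is its neighbour `b`,
an extreme point of the outer triangle. -/
lemma Frame.not_below_below (h : IsPlanarDrawing G p) (F : Frame G p α β a b c v)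
    (hlv : G.Adj v l) (hlb : G.Adj b l) (hla : l ≠ a) (hl : lin α β (p l - p v) < 0)
    (hrv : G.Adj v r) (hra : G.Adj a r) (hrb : r ≠ b) (hr : 0 < lin α β (p r - p v))
    (h1 : σ * cross (p l - p v) (p a - p v) < 0)
    (h2 : 0 < σ * cross (p a - p v) (p r - p v)) : False := by
  have ht : IsTriangle G v r a := ⟨hrv, hra.symm, F.va.symm⟩
  have hmem : p l ∈ Tri (p v) (p r) (p a) :=
    mem_tri_of_left (σ := -σ) h ht hlv F.left hr hl (by rw [cross_swap]; linarith) (by linarith)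
  have hlr : l ≠ r := by rintro rfl; linarith
  exact F.swap.left_notMem h hrv F.va hrb F.tri.ab.ne
    (neighbor_confined h ht hmem hlv.ne.symm hlr hla hlb.symm)

/-- From top to bottom the left neighbours of `v` are `l'`, `l`, `a`. If `l r` passes below `v`, the
triangle `v r l` contains `a`. If it passes above, the triangle contains `b`, either directly or
because it traps `l'`, a neighbour of `b`. Both `a` and `b` are extreme. -/
lemma Frame.not_above_above (h : IsPlanarDrawing G p) (F : Frame G p α β a b c v)
    {l' : V} (hlv : G.Adj v l) (hla : l ≠ a) (hl : lin α β (p l - p v) < 0)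
    (hlv' : G.Adj v l') (hlb' : G.Adj b l') (hl' : lin α β (p l' - p v) < 0)
    (hrv : G.Adj v r) (hrl : G.Adj l r) (hrb : r ≠ b) (hr : 0 < lin α β (p r - p v))
    (hσ : σ ≠ 0) (h1 : 0 < σ * cross (p l - p v) (p a - p v))
    (h2 : 0 < σ * cross (p b - p v) (p l - p v))
    (h3 : 0 < σ * cross (p l' - p v) (p l - p v)) : False := by
  have ht : IsTriangle G v r l := ⟨hrv, hrl.symm, hlv.symm⟩
  have hra : r ≠ a := by rintro rfl; linarith [F.left]
  have hlb : l ≠ b := by rintro rfl; linarith [F.right]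
  have hb := F.swap.left_notMem h hrv hlv hrb hlb
  rcases lt_or_gt_of_ne (mul_ne_zero hσ (cross_ne_zero h ht)) with h4 | h4
  · exact F.left_notMem h hrv hlv hra hla (mem_tri_of_left (σ := -σ) h ht F.va hl hr F.left
      (by linarith) (by rw [cross_swap]; linarith))
  · have hn : cross (p r - p v) (p b - p v) ≠ 0 :=
      cross_ne_zero_of_ray h hrv F.vb hrb (φ := lin α β) (fun _ => rfl) hr F.right
    rcases lt_or_gt_of_ne (mul_ne_zero hσ hn) with h5 | h5
    · have hmem : p l' ∈ Tri (p v) (p r) (p l) := mem_tri_of_left h ht hlv' hl hr hl' h4 h3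
      have hlr : l' ≠ r := by rintro rfl; linarith
      have hll : l' ≠ l := by
        rintro rfl
        simp [cross, mul_comm] at h3
      exact hb (neighbor_confined h ht hmem hlv'.ne.symm hlr hll hlb'.symm)
    · exact hb (mem_tri_of_right h ht F.vb hl hr F.right h4 h5)

/-- Among two triangles `v b l₁`, `v b l₂` with `l₁`, `l₂` to the left of `v`, one has `l` below
`a`, provided that the edges `v l₁` and `v l₂` are in triangles with a third vertex to the right
of `v`. -/
lemma Frame.exists_below (h : IsPlanarDrawing G p) (F : Frame G p α β a b c v) (hσ : σ ≠ 0)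
    {l₁ l₂ r₁ r₂ : V} (hne : l₁ ≠ l₂)
    (hv₁ : G.Adj v l₁) (hb₁ : G.Adj b l₁) (ha₁ : l₁ ≠ a) (hl₁ : lin α β (p l₁ - p v) < 0)
    (hv₂ : G.Adj v l₂) (hb₂ : G.Adj b l₂) (ha₂ : l₂ ≠ a) (hl₂ : lin α β (p l₂ - p v) < 0)
    (hvr₁ : G.Adj v r₁) (hlr₁ : G.Adj l₁ r₁) (hrb₁ : r₁ ≠ b) (hr₁ : 0 < lin α β (p r₁ - p v))
    (hvr₂ : G.Adj v r₂) (hlr₂ : G.Adj l₂ r₂) (hrb₂ : r₂ ≠ b) (hr₂ : 0 < lin α β (p r₂ - p v)) :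
    ∃ l, G.Adj v l ∧ G.Adj b l ∧ l ≠ a ∧ lin α β (p l - p v) < 0 ∧
      σ * cross (p l - p v) (p a - p v) < 0 := by
  rcases F.above_or_below h hv₁ hb₁ ha₁ hl₁ hσ with ⟨h1, h2⟩ | ⟨h1, -⟩
  swap
  · exact ⟨l₁, hv₁, hb₁, ha₁, hl₁, h1⟩
  rcases F.above_or_below h hv₂ hb₂ ha₂ hl₂ hσ with ⟨h3, h4⟩ | ⟨h3, -⟩
  swap
  · exact ⟨l₂, hv₂, hb₂, ha₂, hl₂, h3⟩
  exfalso
  have hn : cross (p l₂ - p v) (p l₁ - p v) ≠ 0 :=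
    cross_ne_zero_of_ray h hv₂ hv₁ hne.symm (φ := lin (-α) (-β)) (fun _ => rfl)
      (by rw [lin_neg]; linarith) (by rw [lin_neg]; linarith)
  rcases lt_or_gt_of_ne (mul_ne_zero hσ hn) with h5 | h5
  · exact F.not_above_above h hv₂ ha₂ hl₂ hv₁ hb₁ hl₁ hvr₂ hlr₂ hrb₂ hr₂ hσ h3 h4
      (by rw [cross_swap]; linarith)
  · exact F.not_above_above h hv₁ ha₁ hl₁ hv₂ hb₂ hl₂ hvr₁ hlr₁ hrb₁ hr₁ hσ h1 h2 h5

/-- The apex of a triangle over the edge `b v`, seen from a frame: `l` is a common neighbour of `v`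
and `b` to the left of `v`, and `r` is a common neighbour of `v` and `l` to the right of `v`. -/
structure Wing (G : SimpleGraph V) (p : V → Plane) (α β : ℝ) (a b v l r : V) : Prop where
  vl : G.Adj v l
  bl : G.Adj b l
  la : l ≠ a
  left : lin α β (p l - p v) < 0
  vr : G.Adj v r
  lr : G.Adj l r
  rb : r ≠ b
  right : 0 < lin α β (p r - p v)

/-- A vertex inside a drawn triangle cannot have two wings on both sides. -/
lemma Frame.false_of_wings (h : IsPlanarDrawing G p) (F : Frame G p α β a b c v)
    {l₁ l₂ r₁ r₂ m₁ m₂ s₁ s₂ : V} (hl : l₁ ≠ l₂) (hm : m₁ ≠ m₂)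
    (W₁ : Wing G p α β a b v l₁ r₁) (W₂ : Wing G p α β a b v l₂ r₂)
    (U₁ : Wing G p (-α) (-β) b a v m₁ s₁) (U₂ : Wing G p (-α) (-β) b a v m₂ s₂) : False := by
  obtain ⟨l, x1, x2, x3, x4, x5⟩ := F.exists_below h (σ := 1) one_ne_zero hl
    W₁.vl W₁.bl W₁.la W₁.left W₂.vl W₂.bl W₂.la W₂.left
    W₁.vr W₁.lr W₁.rb W₁.right W₂.vr W₂.lr W₂.rb W₂.right
  -- Exchanging left and right reverses orientation, so `σ = -1` keeps the meaning of "below" from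
  -- the first half.
  obtain ⟨m, y1, y2, y3, y4, y5⟩ := F.swap.exists_below h (σ := -1) (by norm_num) hm
    U₁.vl U₁.bl U₁.la U₁.left U₂.vl U₂.bl U₂.la U₂.left
    U₁.vr U₁.lr U₁.rb U₁.right U₂.vr U₂.lr U₂.rb U₂.right
  rcases F.swap.above_or_below h (σ := -1) y1 y2 y3 y4 (by norm_num) with ⟨h1, -⟩ | ⟨-, h1⟩
  · linarith
  · rw [lin_neg] at y4
    exact F.not_below_below h x1 x2 x3 x4 y1 y2 y3 (by linarith) x5 (by linarith)

end Frame

end PlanarTwoTree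

namespace PlanarTwoTree

/-! ### Areas of triangles -/

section Area

open MeasureTheory

/-- The open standard triangle. -/
def openSimplex : Set Plane := {s | 0 < s 0 ∧ 0 < s 1 ∧ s 0 + s 1 < 1}

/-- The closed standard triangle. -/
def closedSimplex : Set Plane := {s | 0 ≤ s 0 ∧ 0 ≤ s 1 ∧ s 0 + s 1 ≤ 1}

lemma convex_openSimplex : Convex ℝ openSimplex := by
  rintro x ⟨hx0, hx1, hx⟩ y ⟨hy0, hy1, hy⟩ s t hs ht hst
  simp only [openSimplex, Set.mem_ofPred_eq, PiLp.add_apply, PiLp.smul_apply, smul_eq_mul]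
  rcases hs.eq_or_lt with rfl | hs'
  · obtain rfl : t = 1 := by linarith
    simp [*]
  · refine ⟨by positivity, by positivity, ?_⟩
    nlinarith

lemma isOpen_openSimplex : IsOpen openSimplex := by
  have h0 : IsOpen {s : Plane | 0 < s 0} := isOpen_lt (by fun_prop) (by fun_prop)
  have h1 : IsOpen {s : Plane | 0 < s 1} := isOpen_lt (by fun_prop) (by fun_prop)
  have h2 : IsOpen {s : Plane | s 0 + s 1 < 1} := isOpen_lt (by fun_prop) (by fun_prop)
  exact h0.inter (h1.inter h2)

lemma openSimplex_subset : openSimplex ⊆ closedSimplex :=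
  fun _ h => ⟨h.1.le, h.2.1.le, h.2.2.le⟩

lemma closedSimplex_subset_closure : closedSimplex ⊆ closure openSimplex := by
  rintro s ⟨h0, h1, h2⟩
  let f : ℝ → Plane := fun t => (1 - t) • s + t • !₂[(1 / 3 : ℝ), (1 / 3 : ℝ)]
  have hf : Filter.Tendsto f (nhdsWithin 0 (Set.Ioi 0)) (nhds s) := by
    have hc : Continuous f := by fun_prop
    have := hc.tendsto 0
    simp only [f, sub_zero, one_smul, zero_smul, add_zero] at this
    exact this.mono_left nhdsWithin_le_nhds
  refine mem_closure_of_tendsto hf ?_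
  filter_upwards [Ioo_mem_nhdsGT (zero_lt_one' ℝ)] with t ht
  obtain ⟨ht0, ht1⟩ := ht
  have ht' : 0 < 1 - t := by linarith
  refine ⟨?_, ?_, ?_⟩
  · simp only [f, PiLp.add_apply, PiLp.smul_apply, smul_eq_mul]
    simp only [Matrix.cons_val_zero]
    positivity
  · simp only [f, PiLp.add_apply, PiLp.smul_apply, smul_eq_mul]
    simp only [Matrix.cons_val_one, Matrix.cons_val_zero]
    positivity
  · simp only [f, PiLp.add_apply, PiLp.smul_apply, smul_eq_mul]
    simp only [Matrix.cons_val_one, Matrix.cons_val_zero]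
    nlinarith

/-- The two sets differ only within the frontier of a convex set, which is null. -/
lemma volume_closedSimplex : volume closedSimplex = volume openSimplex := by
  refine le_antisymm ?_ (measure_mono openSimplex_subset)
  calc volume closedSimplex ≤ volume (openSimplex ∪ frontier openSimplex) := by
        apply measure_mono
        intro x hx
        by_cases h : x ∈ openSimplex
        · exact .inl h
        · exact .inr ⟨closedSimplex_subset_closure hx, fun h' => h (interior_subset h')⟩
    _ ≤ volume openSimplex + volume (frontier openSimplex) := measure_union_le _ _
    _ = volume openSimplex := by rw [convex_openSimplex.addHaar_frontier volume, add_zero]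

lemma volume_openSimplex_pos : 0 < volume openSimplex := by
  refine isOpen_openSimplex.measure_pos _ ⟨!₂[(1 / 3 : ℝ), (1 / 3 : ℝ)], ?_, ?_, ?_⟩
  all_goals simp
  norm_num

lemma volume_openSimplex_lt_top : volume openSimplex < ⊤ := by
  refine lt_of_le_of_lt (measure_mono ?_) (measure_closedBall_lt_top (x := (0 : Plane)) (r := 2))
  rintro s ⟨h0, h1, h2⟩
  rw [Metric.mem_closedBall, EuclideanSpace.dist_eq, Real.sqrt_le_left (by norm_num)]
  simp only [Fin.sum_univ_two, Real.dist_eq, PiLp.zero_apply, sub_zero, sq_abs]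
  nlinarith

/-- The linear map sending the standard basis to `b - a`, `c - a`. -/
noncomputable def edgeMap (a b c : Plane) : Plane →ₗ[ℝ] Plane :=
  Matrix.toLpLin 2 2 !![b 0 - a 0, c 0 - a 0; b 1 - a 1, c 1 - a 1]

lemma det_edgeMap (a b c : Plane) : LinearMap.det (edgeMap a b c) = cross (b - a) (c - a) := by
  rw [edgeMap, Matrix.toLpLin_eq_toLin, LinearMap.det_toLin, Matrix.det_fin_two_of, cross_sub]
  ring

lemma edgeMap_zero (a b c s : Plane) :
    edgeMap a b c s 0 = (b 0 - a 0) * s 0 + (c 0 - a 0) * s 1 := by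
  simp [edgeMap, Matrix.toLpLin_apply, dotProduct, Fin.sum_univ_two]

lemma edgeMap_one (a b c s : Plane) :
    edgeMap a b c s 1 = (b 1 - a 1) * s 0 + (c 1 - a 1) * s 1 := by
  simp [edgeMap, Matrix.toLpLin_apply, dotProduct, Fin.sum_univ_two]

lemma inner_eq_image (a b c : Plane) :
    Inner a b c = (fun x => a + x) '' (edgeMap a b c '' openSimplex) := by
  ext P
  simp only [Set.mem_image, exists_exists_and_eq_and]
  constructor
  · rintro ⟨x, y, z, hx, hy, hz, hb⟩
    have hs := hb.sum
    have hx' : x = 1 - y - z := by linarith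
    refine ⟨!₂[y, z], ⟨by simpa, by simpa, by simp; linarith⟩, plane_ext ?_ ?_⟩
    · rw [PiLp.add_apply, edgeMap_zero, hb.fst, hx']; simp; ring
    · rw [PiLp.add_apply, edgeMap_one, hb.snd, hx']; simp; ring
  · rintro ⟨s, ⟨h0, h1, h2⟩, rfl⟩
    refine ⟨1 - s 0 - s 1, s 0, s 1, by linarith, h0, h1, by ring, ?_, ?_⟩
    · rw [PiLp.add_apply, edgeMap_zero]; ring
    · rw [PiLp.add_apply, edgeMap_one]; ring

lemma tri_eq_image (a b c : Plane) :
    Tri a b c = (fun x => a + x) '' (edgeMap a b c '' closedSimplex) := by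
  ext P
  simp only [Set.mem_image, exists_exists_and_eq_and]
  constructor
  · rintro ⟨x, y, z, hx, hy, hz, hb⟩
    have hs := hb.sum
    have hx' : x = 1 - y - z := by linarith
    refine ⟨!₂[y, z], ⟨by simpa, by simpa, by simp; linarith⟩, plane_ext ?_ ?_⟩
    · rw [PiLp.add_apply, edgeMap_zero, hb.fst, hx']; simp; ring
    · rw [PiLp.add_apply, edgeMap_one, hb.snd, hx']; simp; ring
  · rintro ⟨s, ⟨h0, h1, h2⟩, rfl⟩
    refine ⟨1 - s 0 - s 1, s 0, s 1, by linarith, h0, h1, by ring, ?_, ?_⟩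
    · rw [PiLp.add_apply, edgeMap_zero]; ring
    · rw [PiLp.add_apply, edgeMap_one]; ring

lemma volume_inner (a b c : Plane) : volume (Inner a b c) =
    ENNReal.ofReal |cross (b - a) (c - a)| * volume openSimplex := by
  rw [inner_eq_image, Set.image_add_left, measure_preimage_add, Measure.addHaar_image_linearMap,
    det_edgeMap]

lemma volume_tri (a b c : Plane) : volume (Tri a b c) =
    ENNReal.ofReal |cross (b - a) (c - a)| * volume openSimplex := by
  rw [tri_eq_image, Set.image_add_left, measure_preimage_add, Measure.addHaar_image_linearMap,
    det_edgeMap, volume_closedSimplex]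

lemma convex_inner (a b c : Plane) : Convex ℝ (Inner a b c) := by
  rw [inner_eq_image]
  exact (convex_openSimplex.linear_image _).translate a

lemma abs_cross_le_of_subset {a b c u v w : Plane} (h : Tri u v w ⊆ Tri a b c) :
    |cross (v - u) (w - u)| ≤ |cross (b - a) (c - a)| := by
  have := measure_mono (μ := volume) h
  rw [volume_tri, volume_tri] at this
  rwa [ENNReal.mul_le_mul_iff_left volume_openSimplex_pos.ne' volume_openSimplex_lt_top.ne,
    ENNReal.ofReal_le_ofReal_iff (abs_nonneg _)] at this

/-- Additivity of area. The common factor, the volume of the standard triangle, is positive and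
finite and cancels, so it is never computed. -/
lemma abs_cross_add_le_of_disjoint {a b c u v w u' v' w' : Plane} (h : Tri u v w ⊆ Tri a b c)
    (h' : Tri u' v' w' ⊆ Tri a b c) (hd : Disjoint (Inner u v w) (Inner u' v' w')) :
    |cross (v - u) (w - u)| + |cross (v' - u') (w' - u')| ≤ |cross (b - a) (c - a)| := by
  have := measure_mono (μ := volume)
    (Set.union_subset (inner_subset_tri.trans h) (inner_subset_tri.trans h'))
  rw [measure_union₀ ((convex_inner _ _ _).nullMeasurableSet volume) hd.aedisjoint, volume_tri,
    volume_inner, volume_inner, ← add_mul] at this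
  rwa [ENNReal.mul_le_mul_iff_left volume_openSimplex_pos.ne' volume_openSimplex_lt_top.ne,
    ← ENNReal.ofReal_add (abs_nonneg _) (abs_nonneg _),
    ENNReal.ofReal_le_ofReal_iff (abs_nonneg _)] at this

end Area

/-! ### Halving the area of nested triangles -/

section Halving

variable {V : Type} {G : SimpleGraph V} {p : V → Plane} {a b x y z w : V} {k : ℕ}

/-- Two drawn triangles with a common corner are disjoint if neither of them contains a further
corner of the other. -/
lemma disjoint_inner (h : IsPlanarDrawing G p) (hA : IsTriangle G a x z) (hB : IsTriangle G b x w)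
    (hzw : z ≠ w) (ha : p a ∉ Tri (p b) (p x) (p w)) (hb : p b ∉ Tri (p a) (p x) (p z)) :
    Disjoint (Inner (p a) (p x) (p z)) (Inner (p b) (p x) (p w)) := by
  rw [Set.disjoint_left]
  intro P hPA hPB
  -- Moving from a common inner point towards `a`, one leaves the second triangle through a side
  -- while still inside the first. That edge is then confined to the first triangle and drags `b`
  -- into it.
  obtain ⟨Q, hQ, hQt, hside⟩ := exists_mem_side (cross_ne_zero h hB) hPB ha
  have hQa : Q ≠ p a := by rintro rfl; exact ha hQt
  have hQA := inner_of_mem_segment hPA left_mem_tri hQ hQa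
  rcases hside with hs | hs | hs
  · exact hb (edge_confined h hA hB.ab hs hQA)
  · rw [segment_symm] at hs
    refine hb (neighbor_confined h hA (edge_confined h hA hB.bc.symm hs hQA) ?_ hB.bc.ne.symm
      hzw.symm hB.ca)
    rintro rfl
    exact ha right_mem_tri
  · rw [segment_symm] at hs
    exact hb (edge_confined h hA hB.ca.symm hs hQA)

/-- Inside a nested pair of triangles there is another one in a triangle of half the area. -/
lemma Nested.exists_half (h : IsPlanarDrawing G p) (N : Nested G p (k + 1) a b y x) :
    ∃ a' b' y' x', Nested G p k a' b' y' x' ∧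
      |cross (p b' - p a') (p y' - p a')| ≤ |cross (p b - p a) (p y - p a)| / 2 := by
  classical
  obtain ⟨z, z', hzb, -, -, -, N₁⟩ := N.ax.exists_nested h b b
  obtain ⟨w, w', hwa, hwz, -, -, N₂⟩ := N.xb.symm.exists_nested h a z
  have hn := cross_ne_zero h N.isTriangle
  have hz := N.neighbor_mem h N₁.yb.adj.symm
  have hw := N.neighbor_mem h N₂.yb.adj.symm
  have hab := N.ab.adj.ne
  have hax := N.ax.adj.ne
  have hxb := N.xb.adj.ne
  have inj {u v : V} (huv : u ≠ v) : p u ≠ p v := fun e => huv (h.injective e)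
  have ha : p a ∉ Tri (p b) (p x) (p w) :=
    corner_notMem_tri hn middle_mem_tri N.mem hw (inj hab.symm) (inj hax.symm) (inj hwa)
  have hb : p b ∉ Tri (p a) (p x) (p z) :=
    corner_notMem_tri (cross_ne_zero h N.isTriangle.swap) middle_mem_tri (Tri.swap N.mem)
      (Tri.swap hz) (inj hab) (inj hxb) (inj hzb)
  have key := abs_cross_add_le_of_disjoint (tri_subset left_mem_tri N.mem hz)
    (tri_subset middle_mem_tri N.mem hw)
    (disjoint_inner h N₁.isTriangle N₂.isTriangle hwz.symm ha hb)
  rcases le_total |cross (p x - p a) (p z - p a)| |cross (p x - p b) (p w - p b)| with hle | hle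
  · exact ⟨a, x, z, z', N₁, by linarith⟩
  · exact ⟨b, x, w, w', N₂, by linarith⟩

end Halving

end PlanarTwoTree

namespace PlanarTwoTree

/-! ### Thin triangles -/

lemma lin_sub (α β : ℝ) (P Q : Plane) : lin α β (P - Q) = lin α β P - lin α β Q := by
  simp only [lin, PiLp.sub_apply]; ring

lemma IsBary.lin_eq {a b c P : Plane} {x y z : ℝ} (h : IsBary a b c P x y z) (α β : ℝ) :
    lin α β P = x * lin α β a + y * lin α β b + z * lin α β c := by
  simp only [lin, h.fst, h.snd]; ring

lemma dist_sq_eq (P Q : Plane) : dist P Q ^ 2 = (P 0 - Q 0) ^ 2 + (P 1 - Q 1) ^ 2 := by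
  rw [EuclideanSpace.dist_eq, Real.sq_sqrt (by positivity), Fin.sum_univ_two, Real.dist_eq,
    Real.dist_eq, sq_abs, sq_abs]

lemma dist_le_of_mem_tri {a b c P u : Plane} {D : ℝ} (hP : P ∈ Tri a b c) (ha : dist a u ≤ D)
    (hb : dist b u ≤ D) (hc : dist c u ≤ D) : dist P u ≤ D := by
  obtain ⟨x, y, z, hx, hy, hz, h⟩ := hP
  have hs := h.sum
  have e : P - u = x • (a - u) + y • (b - u) + z • (c - u) := by
    apply plane_ext
    · simp only [PiLp.sub_apply, PiLp.add_apply, PiLp.smul_apply, smul_eq_mul, h.fst]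
      linear_combination u 0 * hs
    · simp only [PiLp.sub_apply, PiLp.add_apply, PiLp.smul_apply, smul_eq_mul, h.snd]
      linear_combination u 1 * hs
  rw [dist_eq_norm] at *
  rw [e]
  calc ‖x • (a - u) + y • (b - u) + z • (c - u)‖
      ≤ ‖x • (a - u)‖ + ‖y • (b - u)‖ + ‖z • (c - u)‖ := norm_add₃_le
    _ = x * ‖a - u‖ + y * ‖b - u‖ + z * ‖c - u‖ := by
        rw [norm_smul_of_nonneg hx, norm_smul_of_nonneg hy, norm_smul_of_nonneg hz]
    _ ≤ x * D + y * D + z * D := by gcongr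
    _ = D := by rw [← add_mul, ← add_mul, hs, one_mul]

/-- All sides of the triangle `a b c` have length at most `D`. -/
structure SidesLE (a b c : Plane) (D : ℝ) : Prop where
  ab : dist a b ≤ D
  ac : dist a c ≤ D
  cb : dist c b ≤ D

lemma SidesLE.dist_le {a b c P Q : Plane} {D : ℝ} (h : SidesLE a b c D) (hD : 0 ≤ D)
    (hP : P ∈ Tri a b c) (hQ : Q ∈ Tri a b c) : dist P Q ≤ D := by
  have main : ∀ u, dist a u ≤ D → dist b u ≤ D → dist c u ≤ D → dist P u ≤ D :=
    fun u => dist_le_of_mem_tri hP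
  rw [dist_comm]
  refine dist_le_of_mem_tri hQ ?_ ?_ ?_ <;> rw [dist_comm]
  · exact main a (by simpa) (by rw [dist_comm]; exact h.ab) (by rw [dist_comm]; exact h.ac)
  · exact main b h.ab (by simpa) h.cb
  · exact main c h.ac (by rw [dist_comm]; exact h.cb) (by simpa)

/-- The triangle `P Q R` of diameter at most `D` is almost contained in a line, and the length
`ℓ` of `P Q` is almost its diameter; the functional `lin α β` is the position along `P Q`. -/
structure Strip (α β ℓ D : ℝ) (P Q R : Plane) : Prop where
  len : lin α β Q - lin α β P = ℓ
  one_le : 1 ≤ ℓ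
  lt : D - 1 / 4 < ℓ
  lower : ∀ X ∈ Tri P Q R, ℓ - D ≤ lin α β X - lin α β P
  upper : ∀ X ∈ Tri P Q R, lin α β X - lin α β P ≤ D
  dist_le : ∀ X ∈ Tri P Q R, ∀ Y ∈ Tri P Q R, dist X Y ≤ |lin α β X - lin α β Y| + 1 / 4

lemma Strip.swap {α β ℓ D : ℝ} {P Q R : Plane} (S : Strip α β ℓ D P Q R) :
    Strip (-α) (-β) ℓ D Q P R where
  len := by rw [lin_neg, lin_neg]; linarith [S.len]
  one_le := S.one_le
  lt := S.lt
  lower X hX := by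
    rw [lin_neg, lin_neg]; linarith [S.len, S.upper X (Tri.swap hX)]
  upper X hX := by
    rw [lin_neg, lin_neg]; linarith [S.len, S.lower X (Tri.swap hX)]
  dist_le X hX Y hY := by
    rw [lin_neg, lin_neg, neg_sub_neg, abs_sub_comm]
    exact S.dist_le X (Tri.swap hX) Y (Tri.swap hY)

/-- `lin α β` and `lin (-β) α` are orthonormal coordinates along and across `P Q`. Across, `R`
deviates by the cross product divided by a length at least 1, so by at most `1 / 4`. Along, the
bounds hold because `R` is within `D` of both `P` and `Q`. -/
lemma exists_strip {P Q R : Plane} {D : ℝ} (h : SidesLE P Q R D) (h1 : 1 ≤ dist P Q)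
    (hD : D - 1 / 4 < dist P Q) (hc : |cross (Q - P) (R - P)| ≤ 1 / 4) :
    ∃ α β, Strip α β (dist P Q) D P Q R := by
  set ℓ := dist P Q with hℓ
  have hpos : 0 < ℓ := by linarith
  have hsq : ℓ ^ 2 = (Q 0 - P 0) ^ 2 + (Q 1 - P 1) ^ 2 := by rw [hℓ, dist_sq_eq]; ring
  have hℓD : ℓ ≤ D := h.ab
  set α := (Q 0 - P 0) / ℓ with hα
  set β := (Q 1 - P 1) / ℓ with hβ
  have hαβ : α ^ 2 + β ^ 2 = 1 := by
    rw [hα, hβ]; field_simp; linarith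
  have hQP : lin α β Q - lin α β P = ℓ := by
    rw [← lin_sub]
    simp only [lin, hα, hβ, PiLp.sub_apply]
    field_simp
    linarith
  have hdist : ∀ X Y : Plane,
      dist X Y ^ 2 = (lin α β X - lin α β Y) ^ 2 + (lin (-β) α X - lin (-β) α Y) ^ 2 := by
    intro X Y
    rw [dist_sq_eq]
    simp only [lin]
    linear_combination -((X 0 - Y 0) ^ 2 + (X 1 - Y 1) ^ 2) * hαβ
  have hle : ∀ X Y : Plane, |lin α β X - lin α β Y| ≤ dist X Y := by
    intro X Y
    apply abs_le_of_sq_le_sq _ dist_nonneg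
    rw [hdist]
    linarith [sq_nonneg (lin (-β) α X - lin (-β) α Y)]
  have hle' : ∀ X Y : Plane,
      dist X Y ≤ |lin α β X - lin α β Y| + |lin (-β) α X - lin (-β) α Y| := by
    intro X Y
    apply le_of_sq_le_sq _ (by positivity)
    rw [hdist, add_sq, sq_abs, sq_abs]
    have : 0 ≤ 2 * |lin α β X - lin α β Y| * |lin (-β) α X - lin (-β) α Y| := by positivity
    linarith
  have hR : |lin (-β) α R - lin (-β) α P| ≤ 1 / 4 := by
    have e : lin (-β) α R - lin (-β) α P = cross (Q - P) (R - P) / ℓ := by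
      rw [← lin_sub]
      simp only [lin, hα, hβ, PiLp.sub_apply, cross_sub]
      field_simp
      ring
    rw [e, abs_div, abs_of_pos hpos, div_le_iff₀ hpos]
    linarith
  have hQ : lin (-β) α Q - lin (-β) α P = 0 := by
    rw [← lin_sub]
    simp only [lin, hα, hβ, PiLp.sub_apply]
    field_simp
    ring
  have hPR : dist R P ≤ D := by rw [dist_comm]; exact h.ac
  have hRP := abs_le.1 ((hle R P).trans hPR)
  have hRQ := abs_le.1 ((hle R Q).trans h.cb)
  refine ⟨α, β, hQP, h1, hD, ?_, ?_, ?_⟩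
  · rintro X ⟨x, y, z, hx, hy, hz, hb⟩
    rw [hb.lin_eq]
    have hs := hb.sum
    have hx' : x = 1 - y - z := by linarith
    have e : x * lin α β P + y * lin α β Q + z * lin α β R - lin α β P =
      y * (lin α β Q - lin α β P) + z * (lin α β R - lin α β P) := by rw [hx']; ring
    rw [e, hQP]
    have a1 : 0 ≤ y * ℓ := by positivity
    have a2 : z * (ℓ - D) ≤ z * (lin α β R - lin α β P) :=
      mul_le_mul_of_nonneg_left (by linarith) hz
    have a3 : 1 * (ℓ - D) ≤ z * (ℓ - D) := mul_le_mul_of_nonpos_right (by linarith) (by linarith)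
    linarith
  · rintro X ⟨x, y, z, hx, hy, hz, hb⟩
    rw [hb.lin_eq]
    have hs := hb.sum
    have hx' : x = 1 - y - z := by linarith
    have e : x * lin α β P + y * lin α β Q + z * lin α β R - lin α β P =
      y * (lin α β Q - lin α β P) + z * (lin α β R - lin α β P) := by rw [hx']; ring
    rw [e, hQP]
    have a1 : y * ℓ ≤ y * D := mul_le_mul_of_nonneg_left hℓD hy
    have a2 : z * (lin α β R - lin α β P) ≤ z * D := mul_le_mul_of_nonneg_left (by linarith) hz
    have a3 : (y + z) * D ≤ 1 * D := mul_le_mul_of_nonneg_right (by linarith) (by linarith)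
    linarith
  · rintro X ⟨x, y, z, hx, hy, hz, hb⟩ Y ⟨x', y', z', hx', hy', hz', hb'⟩
    refine (hle' X Y).trans (add_le_add_right ?_ _)
    have e : lin (-β) α X - lin (-β) α Y = (z - z') * (lin (-β) α R - lin (-β) α P) := by
      have e1 : x = 1 - y - z := by linarith [hb.sum]
      have e2 : x' = 1 - y' - z' := by linarith [hb'.sum]
      rw [hb.lin_eq, hb'.lin_eq, e1, e2]
      linear_combination (y - y') * hQ
    rw [e, abs_mul]
    have hz1 : |z - z'| ≤ 1 := abs_le.2 ⟨by linarith [hb'.sum], by linarith [hb.sum]⟩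
    calc |z - z'| * |lin (-β) α R - lin (-β) α P| ≤ 1 * (1 / 4) := by gcongr
      _ = 1 / 4 := one_mul _

/-! ### Descent in the diameter of thin triangles -/

section Descent

variable {V : Type} {G : SimpleGraph V} {p : V → Plane} {a b x y v w : V} {k : ℕ} {D α β ℓ : ℝ}

/-- Some nested pair of triangles with subtrees of depth `k` has small area and sides of length
at most `D`. -/
def HasThin (G : SimpleGraph V) (p : V → Plane) (k : ℕ) (D : ℝ) : Prop :=
  ∃ a b y x, Nested G p k a b y x ∧ |cross (p b - p a) (p y - p a)| ≤ 1 / 4 ∧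
    SidesLE (p a) (p b) (p y) D

/-- In a strip, either the diameter drops, or there is a wing at the inner vertex. -/
lemma Nested.exists_wing (h : IsPlanarDrawing G p)
    (N : Nested G p (k + 2) a b y v) (hc : |cross (p b - p a) (p y - p a)| ≤ 1 / 4)
    (S : Strip α β ℓ D (p a) (p b) (p y)) (hlow : 3 / 4 ≤ lin α β (p v) - lin α β (p a))
    (hup : lin α β (p v) - lin α β (p a) ≤ ℓ - 3 / 4) (hD : ¬ HasThin G p k (D - 1 / 4)) (t : V) :
    ∃ l r, l ≠ t ∧ Wing G p α β a b v l r := by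
  classical
  obtain ⟨l, l', hla, hlt, -, -, N₁⟩ := N.xb.exists_nested h a t
  obtain ⟨r, r', hrb, -, -, -, N₂⟩ := N₁.ay.exists_nested h b b
  have hl := N.neighbor_mem h N₁.ay.adj
  have hr := N.neighbor_mem h N₂.ay.adj
  have lt := S.lt
  have one_le := S.one_le
  have len := S.len
  have lenl := S.lower _ hl
  have lenr := S.lower _ hr
  have uppl := S.upper _ hl
  have uppb := S.upper _ middle_mem_tri
  -- Otherwise the triangle `v b l` has extent at most `D - 1 / 2` along the strip, so sides at most
  -- `D - 1 / 4`. The same estimate for `v l r` forces `r` to the right of `v`.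
  have hleft : lin α β (p l) - lin α β (p a) < 1 / 2 := by
    by_contra! hcon
    refine hD ⟨v, b, l, l', N₁.mono (by omega),
      (abs_cross_le_of_subset (tri_subset N.mem middle_mem_tri hl)).trans hc, ?_, ?_, ?_⟩
    · refine (S.dist_le _ N.mem _ middle_mem_tri).trans ?_
      have : |lin α β (p v) - lin α β (p b)| ≤ D - 1 / 2 := abs_le.2 ⟨by linarith, by linarith⟩
      linarith
    · refine (S.dist_le _ N.mem _ hl).trans ?_
      have : |lin α β (p v) - lin α β (p l)| ≤ D - 1 / 2 := abs_le.2 ⟨by linarith, by linarith⟩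
      linarith
    · refine (S.dist_le _ hl _ middle_mem_tri).trans ?_
      have : |lin α β (p l) - lin α β (p b)| ≤ D - 1 / 2 := abs_le.2 ⟨by linarith, by linarith⟩
      linarith
  have hright : lin α β (p v) < lin α β (p r) := by
    by_contra! hcon
    refine hD ⟨v, l, r, r', N₂,
      (abs_cross_le_of_subset (tri_subset N.mem hl hr)).trans hc, ?_, ?_, ?_⟩
    · refine (S.dist_le _ N.mem _ hl).trans ?_
      have : |lin α β (p v) - lin α β (p l)| ≤ D - 1 / 2 := abs_le.2 ⟨by linarith, by linarith⟩
      linarith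
    · refine (S.dist_le _ N.mem _ hr).trans ?_
      have : |lin α β (p v) - lin α β (p r)| ≤ D - 1 / 2 := abs_le.2 ⟨by linarith, by linarith⟩
      linarith
    · refine (S.dist_le _ hr _ hl).trans ?_
      have : |lin α β (p r) - lin α β (p l)| ≤ D - 1 / 2 := abs_le.2 ⟨by linarith, by linarith⟩
      linarith
  refine ⟨l, r, hlt, N₁.ay.adj, N₁.yb.adj.symm, hla, ?_, N₂.ay.adj, N₂.yb.adj.symm, hrb, ?_⟩
  · rw [lin_sub]; linarith
  · rw [lin_sub]; linarith

/-- A nested pair of triangles over an edge that is almost as long as the diameter leads to a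
triangle of smaller diameter. -/
lemma Nested.hasThin_of_long (h : IsPlanarDrawing G p)
    (hmin : ∀ u v, G.Adj u v → 1 ≤ dist (p u) (p v)) (N : Nested G p (k + 2) a b y v)
    (hc : |cross (p b - p a) (p y - p a)| ≤ 1 / 4) (hs : SidesLE (p a) (p b) (p y) D)
    (hab : D - 1 / 4 < dist (p a) (p b)) : HasThin G p k (D - 1 / 4) := by
  by_contra hD
  obtain ⟨α, β, S⟩ := exists_strip hs (hmin a b N.ab.adj) hab hc
  have hva := (hmin _ _ N.ax.adj.symm).trans (S.dist_le _ N.mem _ left_mem_tri)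
  have hvb := (hmin _ _ N.xb.adj).trans (S.dist_le _ N.mem _ middle_mem_tri)
  have lower := S.lower _ N.mem
  have upper := S.upper _ N.mem
  have len := S.len
  have lt := S.lt
  -- An edge of length at least 1 in a strip of width `1 / 4` advances by at least `3 / 4`. The
  -- opposite direction would leave the strip, which extends less than `1 / 4` beyond either end of
  -- `a b`.
  have hlow : 3 / 4 ≤ lin α β (p v) - lin α β (p a) := by
    rcases le_abs.1 (show 3 / 4 ≤ |lin α β (p v) - lin α β (p a)| by linarith) with e | e <;>
      linarith
  have hup : lin α β (p v) - lin α β (p a) ≤ dist (p a) (p b) - 3 / 4 := by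
    rcases le_abs.1 (show 3 / 4 ≤ |lin α β (p v) - lin α β (p b)| by linarith) with e | e <;>
      linarith
  have F : Frame G p α β a b y v := ⟨N.isTriangle, N.mem, N.ax.adj.symm, N.xb.adj, N.ne,
    by rw [lin_sub]; linarith, by rw [lin_sub]; linarith [S.one_le]⟩
  obtain ⟨l₁, r₁, -, W₁⟩ := N.exists_wing h hc S hlow hup hD v
  obtain ⟨l₂, r₂, hl, W₂⟩ := N.exists_wing h hc S hlow hup hD l₁
  have hc' : |cross (p a - p b) (p y - p b)| ≤ 1 / 4 := by
    refine (abs_cross_le_of_subset (tri_subset ?_ ?_ ?_)).trans hc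
    exacts [middle_mem_tri, left_mem_tri, right_mem_tri]
  have hlow' : 3 / 4 ≤ lin (-α) (-β) (p v) - lin (-α) (-β) (p b) := by
    rw [lin_neg, lin_neg]; linarith
  have hup' : lin (-α) (-β) (p v) - lin (-α) (-β) (p b) ≤ dist (p a) (p b) - 3 / 4 := by
    rw [lin_neg, lin_neg]; linarith
  obtain ⟨m₁, s₁, -, U₁⟩ := N.swap.exists_wing h hc' S.swap hlow' hup' hD v
  obtain ⟨m₂, s₂, hm, U₂⟩ := N.swap.exists_wing h hc' S.swap hlow' hup' hD m₁
  exact F.false_of_wings h hl.symm hm.symm W₁ W₂ U₁ U₂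

/-- The diameter of a thin triangle drops by a constant in a bounded number of levels. -/
lemma HasThin.descend (h : IsPlanarDrawing G p) (hmin : ∀ u v, G.Adj u v → 1 ≤ dist (p u) (p v))
    (hT : HasThin G p (k + 4) D) : HasThin G p k (D - 1 / 4) := by
  classical
  obtain ⟨a, b, y, x, N, hc, hs⟩ := hT
  obtain ⟨z, z', hzb, hzy, -, -, N₁⟩ := N.ax.exists_nested h b y
  have hD : 0 ≤ D := dist_nonneg.trans hs.ab
  have hz := N.neighbor_mem h N₁.yb.adj.symm
  -- A long side of `a x z` has an endpoint `x` or `z` inside the thin triangle `a b y`. Hence a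
  -- nested pair over that side stays in `a b y` and inherits the bounds on area and diameter.
  have main : ∀ i j, p i ∈ Tri (p a) (p b) (p y) → i ≠ a → i ≠ b → i ≠ y →
      Rich G (k + 3) i j → D - 1 / 4 < dist (p i) (p j) → HasThin G p k (D - 1 / 4) := by
    intro i j hi hia hib hiy hr hlong
    obtain ⟨w, v, -, -, -, -, M⟩ := hr.exists_nested h i i
    have hj := neighbor_confined h N.isTriangle hi hia hib hiy hr.adj
    have hw := neighbor_confined h N.isTriangle hi hia hib hiy M.ay.adj
    exact M.hasThin_of_long h hmin ((abs_cross_le_of_subset (tri_subset hi hj hw)).trans hc)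
      ⟨hs.dist_le hD hi hj, hs.dist_le hD hi hw, hs.dist_le hD hw hj⟩ hlong
  by_cases h1 : dist (p a) (p x) ≤ D - 1 / 4
  swap
  · exact main x a N.mem N.ax.adj.ne.symm N.xb.adj.ne N.ne (N.ax.symm.mono (by omega))
      (by rw [dist_comm]; linarith)
  by_cases h2 : dist (p a) (p z) ≤ D - 1 / 4
  swap
  · exact main z a hz N₁.ay.adj.ne.symm hzb hzy N₁.ay.symm (by rw [dist_comm]; linarith)
  by_cases h3 : dist (p z) (p x) ≤ D - 1 / 4
  swap
  · exact main z x hz N₁.ay.adj.ne.symm hzb hzy N₁.yb (by linarith)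
  exact ⟨a, x, z, z', N₁.mono (by omega),
    (abs_cross_le_of_subset (tri_subset left_mem_tri N.mem hz)).trans hc, h1, h2, h3⟩

lemma HasThin.le_length (h : IsPlanarDrawing G p) (hmin : ∀ u v, G.Adj u v → 1 ≤ dist (p u) (p v))
    {j : ℕ} (hT : HasThin G p (4 * j) D) : 1 + (j : ℝ) / 4 ≤ D := by
  induction j generalizing D with
  | zero =>
    obtain ⟨a, b, y, x, N, -, hs⟩ := hT
    simpa using (hmin a b N.ab.adj).trans hs.ab
  | succ j ih =>
    have := ih (HasThin.descend (k := 4 * j) h hmin hT)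
    push_cast
    linarith

lemma Nested.exists_area_le (h : IsPlanarDrawing G p) {j : ℕ} (N : Nested G p (k + j) a b y x) :
    ∃ a' b' y' x', Nested G p k a' b' y' x' ∧
      |cross (p b' - p a') (p y' - p a')| ≤ |cross (p b - p a) (p y - p a)| / 2 ^ j := by
  induction j generalizing a b y x with
  | zero => exact ⟨a, b, y, x, N, by simp⟩
  | succ j ih =>
    obtain ⟨a₁, b₁, y₁, x₁, N₁, h₁⟩ := Nested.exists_half (k := k + j) h N
    obtain ⟨a₂, b₂, y₂, x₂, N₂, h₂⟩ := ih N₁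
    refine ⟨a₂, b₂, y₂, x₂, N₂, h₂.trans ?_⟩
    rw [pow_succ', ← div_div]
    gcongr

lemma abs_cross_le (A B C : Plane) : |cross (B - A) (C - A)| ≤ dist A B * dist A C := by
  apply abs_le_of_sq_le_sq _ (by positivity)
  rw [mul_pow, dist_sq_eq, dist_sq_eq, cross_sub]
  nlinarith [sq_nonneg ((A 0 - B 0) * (A 0 - C 0) + (A 1 - B 1) * (A 1 - C 1))]

/-- In a planar drawing with edges of length at least `1`, a deep subtree contains a long edge. -/
theorem exists_long_edge (h : IsPlanarDrawing G p)
    (hmin : ∀ u v, G.Adj u v → 1 ≤ dist (p u) (p v)) {m : ℕ} (hr : Rich G (18 * m + 3) a b) :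
    ∃ u v, G.Adj u v ∧ (m : ℝ) < dist (p u) (p v) := by
  classical
  by_contra! hmax
  -- The depth `18 * m + 3` splits as follows: one level for the first nested pair, `2 * m + 2`
  -- halvings to go from area `m ^ 2` to at most `1 / 4`, and `4 * m` descents of four levels, which
  -- turn the bound `m` into `1 + m ≤ m`.
  obtain ⟨y, x, -, -, -, -, N⟩ := Rich.exists_nested (k := 4 * (4 * m) + (2 * m + 2)) h
    (hr.mono (by omega)) a a
  obtain ⟨a', b', y', x', N', hc⟩ := N.exists_area_le h
  have h1 : |cross (p b - p a) (p y - p a)| ≤ (m : ℝ) * m :=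
    (abs_cross_le _ _ _).trans (mul_le_mul (hmax _ _ N.ab.adj) (hmax _ _ N.ay.adj) dist_nonneg
      (by positivity))
  have h2 : (m : ℝ) ≤ 2 ^ m := by exact_mod_cast Nat.lt_two_pow_self.le
  have hT : HasThin G p (4 * (4 * m)) m := by
    refine ⟨a', b', y', x', N', hc.trans ?_, hmax _ _ N'.ab.adj, hmax _ _ N'.ay.adj,
      hmax _ _ N'.yb.adj⟩
    have e : (2 : ℝ) ^ (2 * m + 2) = 2 ^ m * 2 ^ m * 4 := by ring
    rw [e, div_le_iff₀ (by positivity)]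
    have : (m : ℝ) * m ≤ 2 ^ m * 2 ^ m := by gcongr
    linarith
  have := hT.le_length h hmin
  push_cast at this
  linarith

end Descent

end PlanarTwoTree

namespace PlanarTwoTree

/-! ### Construction of 2-trees with deep subtrees -/

lemma _root_.IsTwoTree.finite {V : Type} {G : SimpleGraph V} (h : IsTwoTree G) : Finite V := by
  induction h with
  | edge => infer_instance
  | add _ _ ih => exact inferInstance
  | iso e _ ih => exact Finite.of_equiv _ e.toEquiv

/-- The inclusion of a graph in its extension by a vertex. -/
def addHom {V : Type} (G : SimpleGraph V) (a b : V) : G →g addSimplicial G a b where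
  toFun := some
  map_rel' h := h

lemma exists_add_neighbors {V : Type} {G : SimpleGraph V} (hG : IsTwoTree G) {a b : V}
    (hab : G.Adj a b) (m : ℕ) : ∃ (W : Type) (H : SimpleGraph W) (f : G →g H),
      IsTwoTree H ∧ Nat.card W = Nat.card V + m ∧ Function.Injective f ∧
      ∃ C : Finset W, C.card = m ∧ ∀ c ∈ C, H.Adj (f a) c ∧ H.Adj (f b) c := by
  induction m with
  | zero => exact ⟨V, G, .id, hG, by simp, fun _ _ h => h, ∅, by simp⟩
  | succ m ih =>
    obtain ⟨W, H, f, hH, hcard, hf, C, hC, hadj⟩ := ih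
    have := hH.finite
    refine ⟨Option W, addSimplicial H (f a) (f b), (addHom H (f a) (f b)).comp f,
      .add (f.map_adj hab) hH, by rw [Finite.card_option, hcard]; ring,
      (Option.some_injective W).comp hf,
      Finset.insertNone C, by rw [Finset.card_insertNone, hC], ?_⟩
    intro c hc
    rcases c with _ | c
    · exact ⟨.inl rfl, .inr rfl⟩
    · exact hadj c (Finset.some_mem_insertNone.1 hc)

/-- The number of vertices added to obtain a subtree of depth `k` over an edge. -/
def subtreeSize : ℕ → ℕ
  | 0 => 0
  | k + 1 => 5 + subtreeSize k * 10

lemma subtreeSize_lt (k : ℕ) : subtreeSize k < 10 ^ k := by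
  induction k with
  | zero => simp [subtreeSize]
  | succ k ih => rw [subtreeSize, pow_succ]; omega

/-- Many edges are treated at once because one level over an edge creates ten new edges, each
needing a subtree of depth `k`. Subtrees already grown survive later extensions by `Rich.map`. -/
lemma exists_rich (k : ℕ) : ∀ {V : Type} {G : SimpleGraph V}, IsTwoTree G →
    ∀ L : List (V × V), (∀ e ∈ L, G.Adj e.1 e.2) →
    ∃ (W : Type) (H : SimpleGraph W) (f : G →g H), IsTwoTree H ∧
      Nat.card W = Nat.card V + subtreeSize k * L.length ∧ Function.Injective f ∧
      ∀ e ∈ L, Rich H k (f e.1) (f e.2) := by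
  induction k with
  | zero =>
    intro V G hG L hL
    exact ⟨V, G, .id, hG, by simp [subtreeSize], fun _ _ h => h, hL⟩
  | succ k ih =>
    intro V G hG L
    induction L with
    | nil => exact fun _ => ⟨V, G, .id, hG, by simp, fun _ _ h => h, by simp⟩
    | cons e L ihL =>
      intro hL
      obtain ⟨W, H, f, hH, hcard, hf, hR⟩ := ihL fun e he => hL e (List.mem_cons_of_mem _ he)
      have hadj : H.Adj (f e.1) (f e.2) := f.map_adj (hL e List.mem_cons_self)
      obtain ⟨W₁, H₁, f₁, hH₁, hcard₁, hf₁, C, hC, hCadj⟩ := exists_add_neighbors hH hadj 5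
      obtain ⟨W₂, H₂, f₂, hH₂, hcard₂, hf₂, hR₂⟩ := ih hH₁
        (C.toList.map (fun c => (f₁ (f e.1), c)) ++ C.toList.map (fun c => (f₁ (f e.2), c)))
        (by
          intro e' he'
          simp only [List.mem_append, List.mem_map, Finset.mem_toList] at he'
          rcases he' with ⟨c, hc, rfl⟩ | ⟨c, hc, rfl⟩
          · exact (hCadj c hc).1
          · exact (hCadj c hc).2)
      refine ⟨W₂, H₂, f₂.comp (f₁.comp f), hH₂, ?_, hf₂.comp (hf₁.comp hf), ?_⟩
      · rw [hcard₂, hcard₁, hcard]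
        simp only [List.length_append, List.length_map, Finset.length_toList, hC,
          List.length_cons, subtreeSize]
        ring
      · intro e' he'
        rcases List.mem_cons.1 he' with rfl | he'
        · refine ⟨f₂.map_adj (f₁.map_adj hadj), C.map ⟨f₂, hf₂⟩, by simp [hC], ?_⟩
          intro d hd
          obtain ⟨c, hc, rfl⟩ := Finset.mem_map.1 hd
          exact ⟨hR₂ (f₁ (f e'.1), c) (by simp [hc]), hR₂ (f₁ (f e'.2), c) (by simp [hc])⟩
        · exact ((hR e' he').map f₁ hf₁).map f₂ hf₂

lemma exists_twoTree_rich {k n : ℕ} (hn : 10 ^ k + 1 ≤ n) :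
    ∃ (G : SimpleGraph (Fin n)) (a b : Fin n), IsTwoTree G ∧ Rich G k a b := by
  obtain ⟨W, H, f, hH, hcard, hf, hR⟩ := exists_rich k IsTwoTree.edge [(0, 1)] (by simp)
  have hR' := hR (0, 1) (by simp)
  have hlt := subtreeSize_lt k
  -- Further common neighbours of one edge pad the vertex count to exactly `n`.
  obtain ⟨W₁, H₁, f₁, hH₁, hcard₁, hf₁, -⟩ :=
    exists_add_neighbors hH hR'.adj (n - (2 + subtreeSize k))
  have hn₁ : Nat.card W₁ = n := by
    rw [hcard₁, hcard]
    simp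
    omega
  have := hH₁.finite
  let e : W₁ ≃ Fin n := Finite.equivFinOfCardEq hn₁
  let E := SimpleGraph.Iso.map e H₁
  exact ⟨_, _, _, hH₁.iso E, (hR'.map f₁ hf₁).map E.toHom E.injective⟩

end PlanarTwoTree

namespace PlanarTwoTree

/-! ### Planar drawings of 2-trees -/

open Filter Topology

lemma eq_of_mem_segment_of_cross {A X Y P : Plane} (hc : cross (X - A) (Y - A) ≠ 0)
    (hX : P ∈ segment ℝ A X) (hY : P ∈ segment ℝ A Y) : P = A := by
  obtain ⟨s, -, -, e0, e1⟩ := mem_segment_iff.1 hX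
  obtain ⟨t, -, -, f0, f1⟩ := mem_segment_iff.1 hY
  have h : s * cross (X - A) (Y - A) = 0 := by
    simp only [cross_sub]
    linear_combination (Y 1 - A 1) * (f0 - e0) - (Y 0 - A 0) * (f1 - e1)
  obtain rfl : s = 0 := (mul_eq_zero.1 h).resolve_right hc
  exact plane_ext (by rw [e0]; ring) (by rw [e1]; ring)

/-- By compactness of the parameter interval, a segment disjoint from a closed set stays disjoint
from it when its endpoint moves slightly. -/
lemma eventually_disjoint_segment {K : Set Plane} (hK : IsClosed K) {A M : Plane} (N : Plane)
    (hd : Disjoint (segment ℝ A M) K) :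
    ∀ᶠ ε : ℝ in 𝓝 0, ∀ P ∈ segment ℝ A (M + ε • N), P ∉ K := by
  have h : ∀ᶠ ε : ℝ in 𝓝 0, ∀ t ∈ Set.Icc (0 : ℝ) 1, (1 - t) • A + t • (M + ε • N) ∉ K := by
    refine isCompact_Icc.eventually_forall_of_forall_eventually fun t ht => ?_
    have hc : Continuous fun z : ℝ × ℝ => (1 - z.2) • A + z.2 • (M + z.1 • N) := by fun_prop
    refine hc.continuousAt.eventually (hK.isOpen_compl.mem_nhds ?_)
    simp only [zero_smul, add_zero]
    exact Set.disjoint_left.1 hd ⟨1 - t, t, by linarith [ht.2], ht.1, by ring, rfl⟩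
  filter_upwards [h] with ε hε
  rintro P ⟨s, t, hs, ht, hst, rfl⟩
  obtain rfl : s = 1 - t := by linarith
  exact hε t ⟨ht, by linarith⟩

lemma eventually_affine_ne_zero {α β : ℝ} (h : α ≠ 0 ∨ β ≠ 0) :
    ∀ᶠ ε : ℝ in 𝓝[≠] 0, α + ε * β ≠ 0 := by
  by_cases hα : α = 0
  · subst hα
    filter_upwards [self_mem_nhdsWithin] with ε hε
    simpa using ⟨hε, h.resolve_left (by simp)⟩
  · refine Filter.Eventually.filter_mono nhdsWithin_le_nhds ?_
    have hc : Continuous fun ε : ℝ => α + ε * β := by fun_prop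
    exact hc.continuousAt.eventually_ne (by simpa using hα)

variable {V : Type} {G : SimpleGraph V} {p : V → Plane} {a b : V}

/-- The segment from the vertex `a` to `Z` meets the drawing only in `a`. -/
structure MeetsOnlyAt (G : SimpleGraph V) (p : V → Plane) (a : V) (Z : Plane) : Prop where
  edge : ∀ u v, G.Adj u v → ∀ P ∈ segment ℝ (p a) Z, P ∈ segment ℝ (p u) (p v) → P = p a
  vertex : ∀ w, p w ∈ segment ℝ (p a) Z → w = a

lemma cross_ne_zero_or (h : IsPlanarDrawing G p) {v : V} (hv : v ≠ a)
    {N : Plane} (hN : cross (p b - p a) N ≠ 0) :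
    cross (p v - p a) (p b - p a) ≠ 0 ∨ cross (p v - p a) N ≠ 0 := by
  by_contra! hcon
  obtain ⟨h1, h2⟩ := hcon
  have e0 : cross (p b - p a) N * (p v - p a) 0 = 0 := by
    simp only [cross] at *
    linear_combination (p b - p a) 0 * h2 - N 0 * h1
  have e1 : cross (p b - p a) N * (p v - p a) 1 = 0 := by
    simp only [cross] at *
    linear_combination (p b - p a) 1 * h2 - N 1 * h1
  have f0 := (mul_eq_zero.1 e0).resolve_left hN
  have f1 := (mul_eq_zero.1 e1).resolve_left hN
  simp only [PiLp.sub_apply] at f0 f1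
  exact hv (h.injective (plane_ext (by linarith) (by linarith)))

/-- Edges and vertices away from `a` are disjoint from the half edge from `a` to the midpoint, so a
small shift avoids them. For an edge at `a` it suffices that the directions differ; their cross
product is affine in `ε` and not identically zero. It vanishes at `ε = 0` for the edge `a b`, hence
the punctured neighbourhood. -/
lemma eventually_meetsOnlyAt [Finite V] (h : IsPlanarDrawing G p) (hab : G.Adj a b) {N : Plane}
    (hN : cross (p b - p a) N ≠ 0) :
    ∀ᶠ ε : ℝ in 𝓝[≠] 0, MeetsOnlyAt G p a ((1 / 2 : ℝ) • (p a + p b) + ε • N) := by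
  set M : Plane := (1 / 2 : ℝ) • (p a + p b) with hM
  have hne : p a ≠ p b := fun e => hab.ne (h.injective e)
  have hsub : segment ℝ (p a) M ⊆ segment ℝ (p a) (p b) := by
    refine (convex_segment _ _).segment_subset (left_mem_segment ℝ _ _) ?_
    exact ⟨1 / 2, 1 / 2, by norm_num, by norm_num, by norm_num, by rw [hM, smul_add]⟩
  have hb : p b ∉ segment ℝ (p a) M := by
    intro hmem
    obtain ⟨t, ht0, ht1, e0, e1⟩ := mem_segment_iff.1 hmem
    simp only [hM, PiLp.smul_apply, PiLp.add_apply, smul_eq_mul] at e0 e1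
    have ht : 1 - t / 2 ≠ 0 := by intro e; linarith
    refine hne (plane_ext ?_ ?_)
    · refine mul_left_cancel₀ ht ?_
      linear_combination -e0
    · refine mul_left_cancel₀ ht ?_
      linear_combination -e1
  have hray : ∀ v, v ≠ a → ∀ᶠ ε : ℝ in 𝓝[≠] 0,
      cross (p v - p a) (M + ε • N - p a) ≠ 0 := by
    intro v hv
    have := eventually_affine_ne_zero (α := 1 / 2 * cross (p v - p a) (p b - p a))
      (β := cross (p v - p a) N) (by simpa using cross_ne_zero_or h hv hN)
    filter_upwards [this] with ε hε e
    apply hε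
    rw [← e]
    simp only [cross, hM, PiLp.smul_apply, PiLp.add_apply, PiLp.sub_apply, smul_eq_mul]
    ring
  have hvert : ∀ w, ∀ᶠ ε : ℝ in 𝓝[≠] 0, p w ∈ segment ℝ (p a) (M + ε • N) → w = a := by
    intro w
    by_cases hw : w = a
    · exact Eventually.of_forall fun _ _ => hw
    refine Filter.Eventually.filter_mono nhdsWithin_le_nhds ?_
    have hd : Disjoint (segment ℝ (p a) M) {p w} := by
      rw [Set.disjoint_singleton_right]
      intro hmem
      rcases h.vertex_edge a b w hab (hsub hmem) with e | rfl
      · exact hw e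
      · exact hb hmem
    filter_upwards [eventually_disjoint_segment isClosed_singleton N hd] with ε hε hmem
    exact (hε _ hmem rfl).elim
  have hedge : ∀ u v, ∀ᶠ ε : ℝ in 𝓝[≠] 0, G.Adj u v → ∀ P ∈ segment ℝ (p a) (M + ε • N),
      P ∈ segment ℝ (p u) (p v) → P = p a := by
    intro u v
    by_cases huv : G.Adj u v
    swap
    · exact Eventually.of_forall fun _ e => (huv e).elim
    by_cases hu : u = a
    · subst hu
      filter_upwards [hray v huv.ne.symm] with ε hε _ P hP hP'
      exact eq_of_mem_segment_of_cross hε hP' hP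
    by_cases hv : v = a
    · subst hv
      filter_upwards [hray u huv.ne] with ε hε _ P hP hP'
      rw [segment_symm] at hP'
      exact eq_of_mem_segment_of_cross hε hP' hP
    refine Filter.Eventually.filter_mono nhdsWithin_le_nhds ?_
    have hd : Disjoint (segment ℝ (p a) M) (segment ℝ (p u) (p v)) := by
      rw [Set.disjoint_left]
      intro P hP hP'
      have hne' : s(a, b) ≠ s(u, v) := by
        intro e
        rcases Sym2.eq_iff.1 e with ⟨e, -⟩ | ⟨e, -⟩
        · exact hu e.symm
        · exact hv e.symm
      obtain ⟨w, hw1, hw2, rfl⟩ := h.edge_edge a b u v hab huv hne' P ⟨hsub hP, hP'⟩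
      rcases hw1 with rfl | rfl
      · rcases hw2 with e | e
        · exact hu e.symm
        · exact hv e.symm
      · exact hb hP
    have hclosed : IsClosed (segment ℝ (p u) (p v)) := by
      rw [← convexHull_pair]
      exact (Set.toFinite {p u, p v}).isClosed_convexHull ℝ
    filter_upwards [eventually_disjoint_segment hclosed N hd] with ε hε _ P hP hP'
    exact (hε _ hP hP').elim
  filter_upwards [eventually_all.2 hvert, eventually_all.2 fun u => eventually_all.2 (hedge u)]
    with ε h1 h2
  exact ⟨h2, h1⟩

/-- The extension of a drawing by a new vertex at `Z`. -/
def extendDrawing (p : V → Plane) (Z : Plane) : Option V → Plane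
  | none => Z
  | some v => p v

lemma isPlanarDrawing_extend (h : IsPlanarDrawing G p) (hab : G.Adj a b) {Z : Plane}
    (ha : MeetsOnlyAt G p a Z) (hb : MeetsOnlyAt G p b Z)
    (hc : cross (p a - Z) (p b - Z) ≠ 0) :
    IsPlanarDrawing (addSimplicial G a b) (extendDrawing p Z) := by
  have hZ : ∀ w, p w ≠ Z := fun w e => hab.ne <|
    (ha.vertex w (e ▸ right_mem_segment ℝ _ _)).symm.trans
      (hb.vertex w (e ▸ right_mem_segment ℝ _ _))
  have hZe : ∀ u v, G.Adj u v → Z ∉ segment ℝ (p u) (p v) := fun u v huv hmem =>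
    hZ a (ha.edge u v huv Z (right_mem_segment ℝ _ _) hmem).symm
  have hm : ∀ c, c = a ∨ c = b → MeetsOnlyAt G p c Z := by
    rintro c (rfl | rfl) <;> assumption
  have old : ∀ c, c = a ∨ c = b → ∀ u v, G.Adj u v → ∀ P ∈ segment ℝ (p c) Z,
      P ∈ segment ℝ (p u) (p v) → (c = u ∨ c = v) ∧ P = p c := by
    intro c hcab u v huv P hP hP'
    have e := (hm c hcab).edge u v huv P hP hP'
    exact ⟨h.vertex_edge u v c huv (e ▸ hP'), e⟩
  have new : ∀ c d, c = a ∨ c = b → d = a ∨ d = b → c ≠ d → ∀ P ∈ segment ℝ (p c) Z,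
      P ∈ segment ℝ (p d) Z → P = Z := by
    intro c d hc' hd' hcd P hP hP'
    rw [segment_symm] at hP hP'
    rcases hc' with rfl | rfl <;> rcases hd' with rfl | rfl
    · exact (hcd rfl).elim
    · exact eq_of_mem_segment_of_cross hc hP hP'
    · exact eq_of_mem_segment_of_cross hc hP' hP
    · exact (hcd rfl).elim
  refine ⟨?_, ?_, ?_⟩
  · rintro (_ | x) (_ | y) e
    · rfl
    · exact (hZ y e.symm).elim
    · exact (hZ x e).elim
    · exact congrArg some (h.injective e)
  · rintro (_ | u) (_ | v) (_ | w) huv hw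
    · exact huv.elim
    · exact huv.elim
    · exact .inl rfl
    · rw [segment_symm] at hw
      exact .inr (congrArg some ((hm v huv).vertex w hw))
    · exact .inr rfl
    · exact .inl (congrArg some ((hm u huv).vertex w hw))
    · exact (hZe u v huv hw).elim
    · rcases h.vertex_edge u v w huv hw with rfl | rfl
      · exact .inl rfl
      · exact .inr rfl
  · have main : ∀ c, c = a ∨ c = b → ∀ x y, (addSimplicial G a b).Adj x y →
        s(some c, none) ≠ s(x, y) → ∀ P ∈ segment ℝ (p c) Z,
        P ∈ segment ℝ (extendDrawing p Z x) (extendDrawing p Z y) →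
        ∃ w : Option V, (w = some c ∨ w = none) ∧ (w = x ∨ w = y) ∧ P = extendDrawing p Z w := by
      rintro c hc' (_ | x) (_ | y) hxy hne P hP hP'
      · exact hxy.elim
      · have hcy : c ≠ y := by rintro rfl; exact hne Sym2.eq_swap
        rw [segment_symm] at hP'
        exact ⟨none, .inr rfl, .inl rfl, new c y hc' hxy hcy P hP hP'⟩
      · have hcx : c ≠ x := by rintro rfl; exact hne rfl
        exact ⟨none, .inr rfl, .inr rfl, new c x hc' hxy hcx P hP hP'⟩
      · obtain ⟨e, e'⟩ := old c hc' x y hxy P hP hP'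
        exact ⟨some c, .inl rfl, by simpa using e, e'⟩
    rintro u v x y huv hxy hne P ⟨hP, hP'⟩
    rcases u with _ | u
    · rcases v with _ | v
      · exact huv.elim
      · rw [segment_symm] at hP
        obtain ⟨w, h1, h2, h3⟩ := main v huv x y hxy (fun e => hne (Sym2.eq_swap.trans e)) P hP hP'
        exact ⟨w, h1.symm, h2, h3⟩
    rcases v with _ | v
    · exact main u huv x y hxy hne P hP hP'
    rcases x with _ | x
    · rcases y with _ | y
      · exact hxy.elim
      · rw [segment_symm] at hP'
        obtain ⟨w, h1, h2, h3⟩ := main y hxy (some u) (some v) huv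
          (fun e => hne (e.symm.trans Sym2.eq_swap)) P hP' hP
        exact ⟨w, h2, h1.symm, h3⟩
    rcases y with _ | y
    · obtain ⟨w, h1, h2, h3⟩ := main x hxy (some u) (some v) huv (fun e => hne e.symm) P hP' hP
      exact ⟨w, h2, h1, h3⟩
    obtain ⟨w, h1, h2, h3⟩ := h.edge_edge u v x y huv hxy
      (fun e => hne (congrArg (Sym2.map some) e)) P ⟨hP, hP'⟩
    exact ⟨some w, by simpa using h1, by simpa using h2, h3⟩

lemma exists_planarDrawing_add [Finite V] (h : IsPlanarDrawing G p) (hab : G.Adj a b) :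
    ∃ q, IsPlanarDrawing (addSimplicial G a b) q := by
  -- `N` is `p b - p a` turned by a right angle; the new vertex is put close to the midpoint of the
  -- edge, off its line.
  set N : Plane := !₂[p a 1 - p b 1, p b 0 - p a 0] with hN
  have hpos : 0 < (p b 0 - p a 0) ^ 2 + (p b 1 - p a 1) ^ 2 := by
    rw [← dist_sq_eq]
    have : 0 < dist (p b) (p a) := dist_pos.2 fun e => hab.ne (h.injective e.symm)
    positivity
  have e1 : cross (p b - p a) N = (p b 0 - p a 0) ^ 2 + (p b 1 - p a 1) ^ 2 := by
    simp [cross, hN]; ring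
  have e2 : cross (p a - p b) N = -((p b 0 - p a 0) ^ 2 + (p b 1 - p a 1) ^ 2) := by
    simp [cross, hN]; ring
  have h1 := eventually_meetsOnlyAt h hab (N := N) (by rw [e1]; exact hpos.ne')
  have h2 := eventually_meetsOnlyAt h hab.symm (N := N) (by rw [e2]; exact (neg_neg_of_pos hpos).ne)
  rw [add_comm (p b)] at h2
  obtain ⟨ε, ⟨k1, k2⟩, k3⟩ := ((h1.and h2).and self_mem_nhdsWithin).exists
  refine ⟨_, isPlanarDrawing_extend h hab k1 k2 ?_⟩
  have e3 : cross (p a - ((1 / 2 : ℝ) • (p a + p b) + ε • N))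
      (p b - ((1 / 2 : ℝ) • (p a + p b) + ε • N)) =
      ε * ((p b 0 - p a 0) ^ 2 + (p b 1 - p a 1) ^ 2) := by
    simp [cross, hN]; ring
  rw [e3]
  exact mul_ne_zero k3 hpos.ne'

/-- Every 2-tree has a planar straight-line drawing. -/
theorem _root_.IsTwoTree.exists_planarDrawing {V : Type} {G : SimpleGraph V} (hG : IsTwoTree G) :
    ∃ p, IsPlanarDrawing G p := by
  induction hG with
  | edge =>
    refine ⟨fun i => !₂[(i : ℝ), 0], ?_, ?_, ?_⟩
    · intro i j hij
      have := congrArg (fun P : Plane => P 0) hij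
      simpa [Fin.ext_iff] using this
    · intro u v w huv _
      have := huv.ne
      omega
    · intro u v x y huv hxy hne
      have h1 := huv.ne
      have h2 := hxy.ne
      exfalso
      apply hne
      rw [Sym2.eq_iff]
      omega
  | add hab hG ih =>
    obtain ⟨p, hp⟩ := ih
    have := hG.finite
    exact exists_planarDrawing_add hp hab
  | iso e _ ih =>
    obtain ⟨p, hp⟩ := ih
    refine ⟨p ∘ e.symm, hp.injective.comp e.symm.injective, ?_, ?_⟩
    · intro u v w huv hw
      simpa using hp.vertex_edge _ _ _ (e.symm.map_adj_iff.2 huv) hw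
    · intro u v x y huv hxy hne P hP
      obtain ⟨w, h1, h2, h3⟩ := hp.edge_edge _ _ _ _ (e.symm.map_adj_iff.2 huv)
        (e.symm.map_adj_iff.2 hxy)
        (fun he => hne (Sym2.map.injective e.symm.injective (by simpa using he))) P hP
      refine ⟨e w, ?_, ?_, by simpa using h3⟩
      · rcases h1 with rfl | rfl <;> simp
      · rcases h2 with rfl | rfl <;> simp

end PlanarTwoTree

namespace PlanarTwoTree

/-! ### The edge-length ratio -/

lemma _root_.IsPlanarDrawing.smul {V : Type} {G : SimpleGraph V} {p : V → Plane}
    (h : IsPlanarDrawing G p) {t : ℝ} (ht : t ≠ 0) : IsPlanarDrawing G fun v => t • p v := by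
  have hseg : ∀ u v P, P ∈ segment ℝ (t • p u) (t • p v) → t⁻¹ • P ∈ segment ℝ (p u) (p v) := by
    rintro u v P ⟨r, s, hr, hs, hrs, rfl⟩
    refine ⟨r, s, hr, hs, hrs, ?_⟩
    rw [smul_add, smul_comm t⁻¹ r, smul_comm t⁻¹ s, inv_smul_smul₀ ht, inv_smul_smul₀ ht]
  refine ⟨fun u v e => h.injective (smul_right_injective _ ht e), ?_, ?_⟩
  · intro u v w huv hw
    have := hseg u v _ hw
    rw [inv_smul_smul₀ ht] at this
    exact h.vertex_edge u v w huv this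
  · rintro u v x y huv hxy hne P ⟨hP, hP'⟩
    obtain ⟨w, h1, h2, h3⟩ := h.edge_edge u v x y huv hxy hne _ ⟨hseg u v P hP, hseg x y P hP'⟩
    exact ⟨w, h1, h2, by rw [← h3, smul_inv_smul₀ ht]⟩

lemma finite_edgeLengths {V : Type} [Finite V] (G : SimpleGraph V) (p : V → Plane) :
    (edgeLengths G p).Finite := by
  refine (Set.finite_range fun e : V × V => dist (p e.1) (p e.2)).subset ?_
  rintro _ ⟨u, v, -, rfl⟩
  exact ⟨(u, v), rfl⟩

lemma le_drawingRatio {V : Type} [Finite V] {G : SimpleGraph V} {p : V → Plane} {a b : V} {m : ℕ}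
    (h : IsPlanarDrawing G p) (hr : Rich G (18 * m + 3) a b) : (m : ℝ) ≤ drawingRatio G p := by
  have hfin := finite_edgeLengths G p
  obtain ⟨u₀, v₀, hadj, hδ⟩ : sInf (edgeLengths G p) ∈ edgeLengths G p :=
    Set.Nonempty.csInf_mem ⟨_, a, b, hr.adj, rfl⟩ hfin
  set δ := sInf (edgeLengths G p) with hδ'
  have hpos : 0 < δ := by
    rw [hδ]
    exact dist_pos.2 fun e => hadj.ne (h.injective e)
  have hdist : ∀ u v, dist (δ⁻¹ • p u) (δ⁻¹ • p v) = dist (p u) (p v) / δ := by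
    intro u v
    rw [dist_smul₀, Real.norm_of_nonneg (by positivity), div_eq_inv_mul]
  -- The ratio is invariant under scaling, so the shortest edge is normalised to length 1.
  obtain ⟨u, v, huv, hlt⟩ := exists_long_edge (h.smul (inv_ne_zero hpos.ne')) (by
    intro u v huv
    rw [hdist, one_le_div hpos]
    exact csInf_le hfin.bddBelow ⟨u, v, huv, rfl⟩) hr
  rw [hdist] at hlt
  refine hlt.le.trans ?_
  rw [drawingRatio]
  exact div_le_div_of_nonneg_right (le_csSup hfin.bddAbove ⟨u, v, huv, rfl⟩) hpos.le

lemma le_edgeLengthRatio {V : Type} {G : SimpleGraph V} {a b : V} {m : ℕ} (hG : IsTwoTree G)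
    (hr : Rich G (18 * m + 3) a b) : (m : ℝ) ≤ edgeLengthRatio G := by
  have := hG.finite
  obtain ⟨p, hp⟩ := hG.exists_planarDrawing
  refine le_csInf ⟨_, p, hp, rfl⟩ ?_
  rintro _ ⟨q, hq, rfl⟩
  exact le_drawingRatio hq hr

end PlanarTwoTree

open PlanarTwoTree in
theorem corollary3 :
    ∃ c : ℝ, 0 < c ∧ ∃ N : ℕ, ∀ n : ℕ, N ≤ n →
      ∃ G : SimpleGraph (Fin n), IsTwoTree G ∧ c * Real.log (n : ℝ) ≤ edgeLengthRatio G := by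
  -- Here `324 = 9 * 36`, from `log n ≤ 9 * (L + 1)` (as `log 10 ≤ 9`) and `L + 1 ≤ 36 * m`.
  -- Rounding gives `18 * m ≥ L - 20`, so the latter holds once `2 * L - 40 ≥ L + 1`, that is, `L ≥
  -- 41`.
  refine ⟨1 / 324, by norm_num, 10 ^ 41 + 1, fun n hn => ?_⟩
  set L := Nat.log 10 (n - 1) with hL
  have hL41 : 41 ≤ L := Nat.le_log_of_pow_le (by norm_num) (by omega)
  have hle : 10 ^ L ≤ n - 1 := Nat.pow_log_le_self 10 (by omega)
  have hlt : n - 1 < 10 ^ (L + 1) := Nat.lt_pow_succ_log_self (by norm_num) _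
  set m := (L - 3) / 18 with hm
  have hpow : 10 ^ (18 * m + 3) ≤ 10 ^ L := Nat.pow_le_pow_right (by norm_num) (by omega)
  obtain ⟨G, a, b, hG, hr⟩ := exists_twoTree_rich (k := 18 * m + 3) (n := n) (by omega)
  refine ⟨G, hG, le_trans ?_ (le_edgeLengthRatio hG hr)⟩
  have h1 : Real.log n ≤ (L + 1) * 9 := by
    have hn' : (n : ℝ) ≤ 10 ^ (L + 1) := by exact_mod_cast (by omega : n ≤ 10 ^ (L + 1))
    calc Real.log n ≤ Real.log (10 ^ (L + 1)) :=
          Real.log_le_log (by exact_mod_cast (by omega : 0 < n)) hn'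
      _ = (L + 1) * Real.log 10 := by rw [Real.log_pow]; push_cast; ring
      _ ≤ (L + 1) * 9 := by
          gcongr
          linarith [Real.log_le_sub_one_of_pos (show (0 : ℝ) < 10 by norm_num)]
  have h2 : (L : ℝ) + 1 ≤ 36 * m := by
    exact_mod_cast (by omega : L + 1 ≤ 36 * m)
  linarith
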